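/- **Setting.** All algebras are associative over $\mathbb{C}$, not necessarily unital unless stated; $A\sqcup B$ is the free product (coproduct) of algebras and $A\sqcup_1 B$ that of unital algebras. Let $\odot$ be a notion of independence: to linear functionals $\varphi_i:B_i\to\mathbb{C}$ on algebras ($i=1,2$) it assigns a linear functional $\varphi_1\odot\varphi_2$ on $B_1\sqcup B_2$ such that $(\varphi_1\odot\varphi_2)\circ\iota_i=\varphi_i$, $(\varphi_1\odot\varphi_2)\odot\varphi_3=\varphi_1\odot(\varphi_2\odot\varphi_3)$, and $(\varphi_1\circ k_1)\odot(\varphi_2\circ k_2)=(\varphi_1\odot\varphi_2)\circ(k_1\amalg k_2)$ for all algebra homomorphisms $k_i:A_i\to B_i$ (for example the tensor, free, boolean, monotone or anti-monotone product). Let $(B,\Delta,\delta)$ be a dual semigroup: a unital $*$-algebra $B$ with unital $*$-homomorphisms $\Delta:B\to B\sqcup_1 B$ and $\delta:B\to\mathbb{C}$ such that $(\Delta\amalg_1\mathrm{id})\circ\Delta=(\mathrm{id}\amalg_1\Delta)\circ\Delta$ and $(\delta\amalg_1\mathrm{id})\circ\Delta=\mathrm{id}=(\mathrm{id}\amalg_1\delta)\circ\Delta$.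 Put $B_0=\ker\delta$, so $B=\mathbb{C}1\oplus B_0$ and $B\sqcup_1B=\mathbb{C}1\oplus(B_0\sqcup B_0)$. For linear functionals $\varphi,\psi$ on $B$ with $\varphi(1)=\psi(1)=1$ let $\varphi\uplus\psi=(\varphi\odot\psi)\circ\Delta$, where $\varphi\odot\psi$ on $B\sqcup_1 B$ takes the value $1$ at $1$ and equals $\varphi|_{B_0}\odot\psi|_{B_0}$ on $B_0\sqcup B_0$; the empty $\uplus$-product is $\delta$. Let $S(B_0)$ be the symmetric tensor algebra, into which $B=\mathbb{C}1\oplus B_0$ embeds; let $S(\varphi):S(B_0)\to\mathbb{C}$ be the unital homomorphism extending $\varphi|_{B_0}$, and for a linear functional $\Psi$ on $B$ let $D(\Psi):S(B_0)\to\mathbb{C}$ be the linear functional equal to $\Psi$ on $B_0$ and to zero on all other symmetric powers. **Theorem.** There is a coalgebra structure on $S(B_0)$ with counit $S(0)$ that makes it a bialgebra and whose convolution $*$ of linear functionals satisfies $S(\varphi\uplus\psi)=S(\varphi)*S(\psi)$ for all linear functionals $\varphi,\psi$ on $B$ with $\varphi(1)=\psi(1)=1$. For every such structure the following holds. Let $(k_t)_{t\ge0}$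 be linear functionals on $B$ with $$k_t=\delta+t\Psi+R_t\qquad(t\ge0),$$ where $\Psi$ and $R_t$ are linear, $\Psi(1)=0$, $R_t(1)=0$, and for every $b\in B$ there are $C_b\ge0$ and $\epsilon_b>0$ with $|R_t(b)|\le t^2C_b$ for all $0\le t\le\epsilon_b$. Let $S\le T$ be real numbers. Then the series $\exp_*((T-S)D(\Psi))=\sum_{n\ge0}\frac{(T-S)^n}{n!}D(\Psi)^{*n}$ converges pointwise on $S(B_0)$, and for every $b\in B$ $$\lim_{\alpha}\;\bigl(k_{t_2-t_1}\uplus\dots\uplus k_{t_n-t_{n-1}}\bigr)(b)=\exp_*\bigl((T-S)D(\Psi)\bigr)(b),$$ the limit of the net indexed by the partitions $\alpha=\{S=t_1<\dots<t_n=T\}$ of $[S,T]$, ordered by inclusion. -/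

import Mathlib

universe u v w

set_option linter.unusedSectionVars false

noncomputable section

/-! ### The free product of unital algebras -/

namespace UnitalCoprod

variable (A : Type u) (B : Type v) [Ring A] [Algebra ℂ A] [Ring B] [Algebra ℂ B]

/-- The relations turning the tensor algebra of the vector space `A × B` into the free product of
the unital algebras `A` and `B`. -/
inductive Rel : TensorAlgebra ℂ (A × B) → TensorAlgebra ℂ (A × B) → Prop
  | one_left : Rel (TensorAlgebra.ι ℂ ((1 : A), (0 : B))) 1
  | one_right : Rel (TensorAlgebra.ι ℂ ((0 : A), (1 : B))) 1
  | mul_left (a a' : A) : Rel (TensorAlgebra.ι ℂ (a * a', (0 : B)))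
      (TensorAlgebra.ι ℂ (a, (0 : B)) * TensorAlgebra.ι ℂ (a', (0 : B)))
  | mul_right (b b' : B) : Rel (TensorAlgebra.ι ℂ ((0 : A), b * b'))
      (TensorAlgebra.ι ℂ ((0 : A), b) * TensorAlgebra.ι ℂ ((0 : A), b'))

end UnitalCoprod

/-- The free product (coproduct) `A ⊔₁ B` of unital complex algebras. -/
def UnitalCoprod (A : Type u) (B : Type v) [Ring A] [Algebra ℂ A] [Ring B] [Algebra ℂ B] :
    Type (max u v) :=
  RingQuot (UnitalCoprod.Rel A B)

namespace UnitalCoprod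

variable {A : Type u} {B : Type v} {C : Type w} [Ring A] [Algebra ℂ A] [Ring B] [Algebra ℂ B]
  [Ring C] [Algebra ℂ C]

instance : Ring (UnitalCoprod A B) := inferInstanceAs (Ring (RingQuot (Rel A B)))

instance : Algebra ℂ (UnitalCoprod A B) := inferInstanceAs (Algebra ℂ (RingQuot (Rel A B)))

/-- The quotient map from the tensor algebra. -/
def mk (A : Type u) (B : Type v) [Ring A] [Algebra ℂ A] [Ring B] [Algebra ℂ B] :
    TensorAlgebra ℂ (A × B) →ₐ[ℂ] UnitalCoprod A B :=
  RingQuot.mkAlgHom ℂ (Rel A B)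

/-- The canonical embedding of the left factor. -/
def inl : A →ₐ[ℂ] UnitalCoprod A B :=
  AlgHom.ofLinearMap ((mk A B).toLinearMap ∘ₗ TensorAlgebra.ι ℂ ∘ₗ LinearMap.inl ℂ A B)
    ((RingQuot.mkAlgHom_rel ℂ (Rel.one_left (A := A) (B := B))).trans (map_one (mk A B)))
    (fun a a' => (RingQuot.mkAlgHom_rel ℂ (Rel.mul_left (B := B) a a')).trans
      (map_mul (mk A B) _ _))

/-- The canonical embedding of the right factor. -/
def inr : B →ₐ[ℂ] UnitalCoprod A B :=
  AlgHom.ofLinearMap ((mk A B).toLinearMap ∘ₗ TensorAlgebra.ι ℂ ∘ₗ LinearMap.inr ℂ A B)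
    ((RingQuot.mkAlgHom_rel ℂ (Rel.one_right (A := A) (B := B))).trans (map_one (mk A B)))
    (fun b b' => (RingQuot.mkAlgHom_rel ℂ (Rel.mul_right (A := A) b b')).trans
      (map_mul (mk A B) _ _))

/-- The homomorphism `f ⊔₁ g` given by the universal property of the free product. -/
def lift (f : A →ₐ[ℂ] C) (g : B →ₐ[ℂ] C) : UnitalCoprod A B →ₐ[ℂ] C :=
  RingQuot.liftAlgHom ℂ
    ⟨TensorAlgebra.lift ℂ (f.toLinearMap.coprod g.toLinearMap), by
      intro x y h
      cases h <;> simp⟩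

@[simp]
theorem lift_inl (f : A →ₐ[ℂ] C) (g : B →ₐ[ℂ] C) (a : A) : lift f g (inl a) = f a := by
  have h := RingQuot.liftAlgHom_mkAlgHom_apply (S := ℂ) (s := Rel A B)
    (TensorAlgebra.lift ℂ (f.toLinearMap.coprod g.toLinearMap))
    (by intro x y h; cases h <;> simp) (TensorAlgebra.ι ℂ (a, (0 : B)))
  refine h.trans ?_
  simp

@[simp]
theorem lift_inr (f : A →ₐ[ℂ] C) (g : B →ₐ[ℂ] C) (b : B) : lift f g (inr b) = g b := by
  have h := RingQuot.liftAlgHom_mkAlgHom_apply (S := ℂ) (s := Rel A B)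
    (TensorAlgebra.lift ℂ (f.toLinearMap.coprod g.toLinearMap))
    (by intro x y h; cases h <;> simp) (TensorAlgebra.ι ℂ ((0 : A), b))
  refine h.trans ?_
  simp

theorem hom_ext {F G : UnitalCoprod A B →ₐ[ℂ] C} (hl : ∀ a, F (inl a) = G (inl a))
    (hr : ∀ b, F (inr b) = G (inr b)) : F = G := by
  apply RingQuot.ringQuot_ext'
  apply TensorAlgebra.hom_ext
  apply LinearMap.ext
  rintro ⟨a, b⟩
  have e : ((a, b) : A × B) = (a, 0) + (0, b) := by simp
  have h1 := hl a
  have h2 := hr b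
  rw [e, map_add, map_add]
  exact congrArg₂ (· + ·) h1 h2

/-- The homomorphism `f ⨿₁ g : A ⊔₁ B → A' ⊔₁ B'`. -/
def map {A' B' : Type*} [Ring A'] [Algebra ℂ A'] [Ring B'] [Algebra ℂ B']
    (f : A →ₐ[ℂ] A') (g : B →ₐ[ℂ] B') : UnitalCoprod A B →ₐ[ℂ] UnitalCoprod A' B' :=
  lift (inl.comp f) (inr.comp g)

/-- The canonical identification `(A ⊔₁ B) ⊔₁ C → A ⊔₁ (B ⊔₁ C)`. -/
def assoc : UnitalCoprod (UnitalCoprod A B) C →ₐ[ℂ] UnitalCoprod A (UnitalCoprod B C) :=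
  lift (lift inl (inr.comp inl)) (inr.comp inr)

/-- The opposite of a complex algebra, with the conjugate scalar multiplication. An algebra
homomorphism into it is a conjugate linear antihomomorphism. -/
def ConjOp (A : Type u) : Type u := Aᵐᵒᵖ

instance : Ring (ConjOp A) := inferInstanceAs (Ring Aᵐᵒᵖ)

instance : Algebra ℂ (ConjOp A) where
  algebraMap := (algebraMap ℂ Aᵐᵒᵖ).comp (starRingEnd ℂ)
  smul c x := MulOpposite.op ((starRingEnd ℂ c) • MulOpposite.unop x)
  commutes' c x := Algebra.commutes (A := Aᵐᵒᵖ) (starRingEnd ℂ c) x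
  smul_def' c x := Algebra.smul_def (A := Aᵐᵒᵖ) (starRingEnd ℂ c) x

/-- The identity map onto the conjugate opposite algebra. -/
def toConjOp (a : A) : ConjOp A := MulOpposite.op a

/-- The identity map from the conjugate opposite algebra. -/
def ofConjOp (a : ConjOp A) : A := MulOpposite.unop a

theorem ofConjOp_mul (a b : ConjOp A) : ofConjOp (a * b) = ofConjOp b * ofConjOp a := rfl

theorem ofConjOp_add (a b : ConjOp A) : ofConjOp (a + b) = ofConjOp a + ofConjOp b := rfl

theorem ofConjOp_algebraMap (c : ℂ) :
    ofConjOp (algebraMap ℂ (ConjOp A) c) = algebraMap ℂ A (starRingEnd ℂ c) := rfl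

/-- A unital algebra homomorphism, composed with the involution of its source. -/
def starComp [StarRing A] [StarModule ℂ A] (f : A →ₐ[ℂ] C) : A →ₐ[ℂ] ConjOp C where
  toFun a := toConjOp (f (star a))
  map_one' := by
    simp only [star_one, map_one]; rfl
  map_mul' a b := by
    simp only [star_mul, map_mul]; rfl
  map_zero' := by
    simp only [star_zero, map_zero]; rfl
  map_add' a b := by
    simp only [star_add, map_add]; rfl
  commutes' c := by
    rw [← algebraMap_star_comm, AlgHom.commutes]; rfl

section Star

variable [StarRing A] [StarModule ℂ A] [StarRing B] [StarModule ℂ B]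

/-- The involution of the free product of unital star algebras, as a homomorphism into the
conjugate opposite algebra. -/
def starHom (A : Type u) (B : Type v) [Ring A] [Algebra ℂ A] [Ring B] [Algebra ℂ B]
    [StarRing A] [StarModule ℂ A] [StarRing B] [StarModule ℂ B] :
    UnitalCoprod A B →ₐ[ℂ] ConjOp (UnitalCoprod A B) :=
  lift (starComp inl) (starComp inr)

/-- The involution applied twice. -/
def starStar (A : Type u) (B : Type v) [Ring A] [Algebra ℂ A] [Ring B] [Algebra ℂ B]
    [StarRing A] [StarModule ℂ A] [StarRing B] [StarModule ℂ B] :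
    UnitalCoprod A B →ₐ[ℂ] UnitalCoprod A B where
  toFun x := ofConjOp (starHom A B (ofConjOp (starHom A B x)))
  map_one' := by
    rw [map_one]; exact congrArg ofConjOp (map_one (starHom A B))
  map_mul' x y := by
    rw [map_mul, ofConjOp_mul, map_mul, ofConjOp_mul]
  map_zero' := by
    rw [map_zero]; exact congrArg ofConjOp (map_zero (starHom A B))
  map_add' x y := by
    rw [map_add, ofConjOp_add, map_add, ofConjOp_add]
  commutes' c := by
    rw [AlgHom.commutes, ofConjOp_algebraMap, AlgHom.commutes, ofConjOp_algebraMap,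
      Complex.conj_conj]

theorem starStar_eq : starStar A B = AlgHom.id ℂ (UnitalCoprod A B) := by
  apply hom_ext
  · intro a
    change ofConjOp (starHom A B (ofConjOp (starHom A B (inl a)))) = inl a
    have h : ∀ a : A, ofConjOp (starHom A B (inl a)) = inl (star a) := fun a => by
      rw [starHom, lift_inl]; rfl
    rw [h, h, star_star]
  · intro b
    change ofConjOp (starHom A B (ofConjOp (starHom A B (inr b)))) = inr b
    have h : ∀ b : B, ofConjOp (starHom A B (inr b)) = inr (star b) := fun b => by
      rw [starHom, lift_inr]; rfl
    rw [h, h, star_star]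

/-- The free product of unital star algebras is a star algebra, with `star` extending the
involutions of both factors. -/
instance : StarRing (UnitalCoprod A B) where
  star x := ofConjOp (starHom A B x)
  star_involutive x := DFunLike.congr_fun (starStar_eq (A := A) (B := B)) x
  star_mul x y := by
    change ofConjOp (starHom A B (x * y)) = _
    rw [map_mul, ofConjOp_mul]
  star_add x y := by
    change ofConjOp (starHom A B (x + y)) = _
    rw [map_add, ofConjOp_add]

theorem star_inl (a : A) : star (inl a : UnitalCoprod A B) = inl (star a) := by
  change ofConjOp (starHom A B (inl a)) = _
  rw [starHom, lift_inl]; rfl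

theorem star_inr (b : B) : star (inr b : UnitalCoprod A B) = inr (star b) := by
  change ofConjOp (starHom A B (inr b)) = _
  rw [starHom, lift_inr]; rfl

instance : StarModule ℂ (UnitalCoprod A B) where
  star_smul c x := by
    change ofConjOp (starHom A B (c • x)) = _
    rw [map_smul]; rfl

end Star

end UnitalCoprod

/-! ### The free product of (not necessarily unital) algebras -/

/-- The free product (coproduct) `A ⊔ B` of not necessarily unital complex algebras: the
subalgebra generated by `A` and `B` in the unital free product of their unitizations. -/
def AlgCoprod (A : Type u) (B : Type v) [NonUnitalRing A] [Module ℂ A] [IsScalarTower ℂ A A]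
    [SMulCommClass ℂ A A] [NonUnitalRing B] [Module ℂ B] [IsScalarTower ℂ B B]
    [SMulCommClass ℂ B B] : Type (max u v) :=
  NonUnitalAlgebra.adjoin ℂ
    (Set.range (fun a : A => (UnitalCoprod.inl (Unitization.inr a : Unitization ℂ A) :
        UnitalCoprod (Unitization ℂ A) (Unitization ℂ B))) ∪
      Set.range (fun b : B => (UnitalCoprod.inr (Unitization.inr b : Unitization ℂ B) :
        UnitalCoprod (Unitization ℂ A) (Unitization ℂ B))))

namespace AlgCoprod

variable {A : Type u} {B : Type v} {C : Type w}
  [NonUnitalRing A] [Module ℂ A] [IsScalarTower ℂ A A] [SMulCommClass ℂ A A]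
  [NonUnitalRing B] [Module ℂ B] [IsScalarTower ℂ B B] [SMulCommClass ℂ B B]
  [NonUnitalRing C] [Module ℂ C] [IsScalarTower ℂ C C] [SMulCommClass ℂ C C]

instance : NonUnitalRing (AlgCoprod A B) := by unfold AlgCoprod; infer_instance

instance : Module ℂ (AlgCoprod A B) := by unfold AlgCoprod; infer_instance

instance : IsScalarTower ℂ (AlgCoprod A B) (AlgCoprod A B) := by
  unfold AlgCoprod; infer_instance

instance : SMulCommClass ℂ (AlgCoprod A B) (AlgCoprod A B) := by
  unfold AlgCoprod; infer_instance

/-- The inclusion of the free product into the unital free product of the unitizations. -/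
def incl (A : Type u) (B : Type v)
    [NonUnitalRing A] [Module ℂ A] [IsScalarTower ℂ A A] [SMulCommClass ℂ A A]
    [NonUnitalRing B] [Module ℂ B] [IsScalarTower ℂ B B] [SMulCommClass ℂ B B] :
    AlgCoprod A B →ₙₐ[ℂ] UnitalCoprod (Unitization ℂ A) (Unitization ℂ B) where
  toFun x := x.1
  map_smul' _ _ := rfl
  map_zero' := rfl
  map_add' _ _ := rfl
  map_mul' _ _ := rfl

theorem incl_injective : Function.Injective (incl A B) := Subtype.val_injective

/-- The canonical embedding of the left factor. -/
def inl : A →ₙₐ[ℂ] AlgCoprod A B where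
  toFun a := ⟨UnitalCoprod.inl (Unitization.inr a),
    NonUnitalAlgebra.subset_adjoin ℂ (Or.inl ⟨a, rfl⟩)⟩
  map_smul' c a := incl_injective (by
    change UnitalCoprod.inl (Unitization.inr (c • a)) = c • UnitalCoprod.inl (Unitization.inr a)
    simp)
  map_zero' := incl_injective (by
    change UnitalCoprod.inl (Unitization.inr (0 : A)) = 0
    simp)
  map_add' a b := incl_injective (by
    change UnitalCoprod.inl (Unitization.inr (a + b)) =
      UnitalCoprod.inl (Unitization.inr a) + UnitalCoprod.inl (Unitization.inr b)
    simp)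
  map_mul' a b := incl_injective (by
    change UnitalCoprod.inl (Unitization.inr (a * b)) =
      UnitalCoprod.inl (Unitization.inr a) * UnitalCoprod.inl (Unitization.inr b)
    simp)

/-- The canonical embedding of the right factor. -/
def inr : B →ₙₐ[ℂ] AlgCoprod A B where
  toFun b := ⟨UnitalCoprod.inr (Unitization.inr b),
    NonUnitalAlgebra.subset_adjoin ℂ (Or.inr ⟨b, rfl⟩)⟩
  map_smul' c a := incl_injective (by
    change UnitalCoprod.inr (Unitization.inr (c • a)) = c • UnitalCoprod.inr (Unitization.inr a)
    simp)
  map_zero' := incl_injective (by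
    change UnitalCoprod.inr (Unitization.inr (0 : B)) = 0
    simp)
  map_add' a b := incl_injective (by
    change UnitalCoprod.inr (Unitization.inr (a + b)) =
      UnitalCoprod.inr (Unitization.inr a) + UnitalCoprod.inr (Unitization.inr b)
    simp)
  map_mul' a b := incl_injective (by
    change UnitalCoprod.inr (Unitization.inr (a * b)) =
      UnitalCoprod.inr (Unitization.inr a) * UnitalCoprod.inr (Unitization.inr b)
    simp)

/-- The free product is generated by its two factors. -/
theorem induction {p : AlgCoprod A B → Prop} (hl : ∀ a, p (inl a)) (hr : ∀ b, p (inr b))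
    (hadd : ∀ x y, p x → p y → p (x + y)) (hzero : p 0)
    (hmul : ∀ x y, p x → p y → p (x * y)) (hsmul : ∀ (c : ℂ) x, p x → p (c • x)) (x) : p x := by
  obtain ⟨x, hx⟩ := x
  induction hx using NonUnitalAlgebra.adjoin_induction with
  | mem x h =>
    rcases h with ⟨a, rfl⟩ | ⟨b, rfl⟩
    · exact hl a
    · exact hr b
  | add x y hx hy h1 h2 => exact hadd ⟨x, hx⟩ ⟨y, hy⟩ h1 h2
  | zero => exact hzero
  | mul x y hx hy h1 h2 => exact hmul ⟨x, hx⟩ ⟨y, hy⟩ h1 h2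
  | smul c x hx h => exact hsmul c ⟨x, hx⟩ h

theorem hom_ext {F G : AlgCoprod A B →ₙₐ[ℂ] C} (hl : ∀ a, F (inl a) = G (inl a))
    (hr : ∀ b, F (inr b) = G (inr b)) : F = G := by
  ext x
  induction x using induction with
  | hl a => exact hl a
  | hr b => exact hr b
  | hadd x y h1 h2 => rw [map_add, map_add, h1, h2]
  | hzero => rw [map_zero, map_zero]
  | hmul x y h1 h2 => rw [map_mul, map_mul, h1, h2]
  | hsmul c x h => rw [map_smul, map_smul, h]

/-- The extension of `f` and `g` to the unital free product of the unitizations. -/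
def unitLift (f : A →ₙₐ[ℂ] C) (g : B →ₙₐ[ℂ] C) :
    UnitalCoprod (Unitization ℂ A) (Unitization ℂ B) →ₐ[ℂ] Unitization ℂ C :=
  UnitalCoprod.lift (Unitization.lift ((Unitization.inrNonUnitalAlgHom ℂ C).comp f))
    (Unitization.lift ((Unitization.inrNonUnitalAlgHom ℂ C).comp g))

theorem unitLift_inl (f : A →ₙₐ[ℂ] C) (g : B →ₙₐ[ℂ] C) (a : A) :
    unitLift f g (incl A B (inl a)) = Unitization.inr (f a) := by
  change unitLift f g (UnitalCoprod.inl (Unitization.inr a)) = _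
  simp [unitLift]

theorem unitLift_inr (f : A →ₙₐ[ℂ] C) (g : B →ₙₐ[ℂ] C) (b : B) :
    unitLift f g (incl A B (inr b)) = Unitization.inr (g b) := by
  change unitLift f g (UnitalCoprod.inr (Unitization.inr b)) = _
  simp [unitLift]

theorem fst_unitLift (f : A →ₙₐ[ℂ] C) (g : B →ₙₐ[ℂ] C) (x : AlgCoprod A B) :
    (unitLift f g (incl A B x)).fst = 0 := by
  induction x using induction with
  | hl a => rw [unitLift_inl, Unitization.fst_inr]
  | hr b => rw [unitLift_inr, Unitization.fst_inr]
  | hadd x y h1 h2 => rw [map_add, map_add, Unitization.fst_add, h1, h2, add_zero]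
  | hzero => rw [map_zero, map_zero, Unitization.fst_zero]
  | hmul x y h1 h2 => rw [map_mul, map_mul, Unitization.fst_mul, h1, zero_mul]
  | hsmul c x h => rw [map_smul, map_smul, Unitization.fst_smul, h, smul_zero]

/-- The homomorphism `f ⊔ g` given by the universal property of the free product. -/
def lift (f : A →ₙₐ[ℂ] C) (g : B →ₙₐ[ℂ] C) : AlgCoprod A B →ₙₐ[ℂ] C where
  toFun x := (unitLift f g (incl A B x)).snd
  map_smul' c x := by simp
  map_zero' := by simp
  map_add' x y := by simp
  map_mul' x y := by simp [fst_unitLift]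

@[simp]
theorem lift_inl (f : A →ₙₐ[ℂ] C) (g : B →ₙₐ[ℂ] C) (a : A) : lift f g (inl a) = f a := by
  change (unitLift f g (incl A B (inl a))).snd = _
  rw [unitLift_inl, Unitization.snd_inr]

@[simp]
theorem lift_inr (f : A →ₙₐ[ℂ] C) (g : B →ₙₐ[ℂ] C) (b : B) : lift f g (inr b) = g b := by
  change (unitLift f g (incl A B (inr b))).snd = _
  rw [unitLift_inr, Unitization.snd_inr]

/-- The homomorphism `f ⨿ g : A ⊔ B → A' ⊔ B'`. -/
def map {A' B' : Type*}
    [NonUnitalRing A'] [Module ℂ A'] [IsScalarTower ℂ A' A'] [SMulCommClass ℂ A' A']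
    [NonUnitalRing B'] [Module ℂ B'] [IsScalarTower ℂ B' B'] [SMulCommClass ℂ B' B']
    (f : A →ₙₐ[ℂ] A') (g : B →ₙₐ[ℂ] B') : AlgCoprod A B →ₙₐ[ℂ] AlgCoprod A' B' :=
  lift (inl.comp f) (inr.comp g)

/-- The canonical identification `(A ⊔ B) ⊔ C → A ⊔ (B ⊔ C)`. -/
def assoc : AlgCoprod (AlgCoprod A B) C →ₙₐ[ℂ] AlgCoprod A (AlgCoprod B C) :=
  lift (lift inl (inr.comp inl)) (inr.comp inr)

end AlgCoprod

/-! ### Notions of independence -/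

/-- A notion of independence: a product `φ₁ ⊙ φ₂` of linear functionals on algebras, which is a
linear functional on the free product of the algebras, extends both factors, is associative, and
is natural with respect to algebra homomorphisms. The tensor, free, boolean, monotone and
anti-monotone products are examples. -/
structure Independence where
  /-- The product `φ ⊙ ψ` on the free product `A ⊔ B`. -/
  prod : ∀ {A B : Type u}
    [NonUnitalRing A] [Module ℂ A] [IsScalarTower ℂ A A] [SMulCommClass ℂ A A]
    [NonUnitalRing B] [Module ℂ B] [IsScalarTower ℂ B B] [SMulCommClass ℂ B B],
    (A →ₗ[ℂ] ℂ) → (B →ₗ[ℂ] ℂ) → (AlgCoprod A B →ₗ[ℂ] ℂ)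
  prod_inl : ∀ {A B : Type u}
    [NonUnitalRing A] [Module ℂ A] [IsScalarTower ℂ A A] [SMulCommClass ℂ A A]
    [NonUnitalRing B] [Module ℂ B] [IsScalarTower ℂ B B] [SMulCommClass ℂ B B]
    (φ : A →ₗ[ℂ] ℂ) (ψ : B →ₗ[ℂ] ℂ) (a : A), prod φ ψ (AlgCoprod.inl a) = φ a
  prod_inr : ∀ {A B : Type u}
    [NonUnitalRing A] [Module ℂ A] [IsScalarTower ℂ A A] [SMulCommClass ℂ A A]
    [NonUnitalRing B] [Module ℂ B] [IsScalarTower ℂ B B] [SMulCommClass ℂ B B]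
    (φ : A →ₗ[ℂ] ℂ) (ψ : B →ₗ[ℂ] ℂ) (b : B), prod φ ψ (AlgCoprod.inr b) = ψ b
  prod_assoc : ∀ {A B C : Type u}
    [NonUnitalRing A] [Module ℂ A] [IsScalarTower ℂ A A] [SMulCommClass ℂ A A]
    [NonUnitalRing B] [Module ℂ B] [IsScalarTower ℂ B B] [SMulCommClass ℂ B B]
    [NonUnitalRing C] [Module ℂ C] [IsScalarTower ℂ C C] [SMulCommClass ℂ C C]
    (φ : A →ₗ[ℂ] ℂ) (ψ : B →ₗ[ℂ] ℂ) (χ : C →ₗ[ℂ] ℂ) (x : AlgCoprod (AlgCoprod A B) C),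
    prod (prod φ ψ) χ x = prod φ (prod ψ χ) (AlgCoprod.assoc x)
  prod_comp : ∀ {A A' B B' : Type u}
    [NonUnitalRing A] [Module ℂ A] [IsScalarTower ℂ A A] [SMulCommClass ℂ A A]
    [NonUnitalRing B] [Module ℂ B] [IsScalarTower ℂ B B] [SMulCommClass ℂ B B]
    [NonUnitalRing A'] [Module ℂ A'] [IsScalarTower ℂ A' A'] [SMulCommClass ℂ A' A']
    [NonUnitalRing B'] [Module ℂ B'] [IsScalarTower ℂ B' B'] [SMulCommClass ℂ B' B']
    (φ : A' →ₗ[ℂ] ℂ) (ψ : B' →ₗ[ℂ] ℂ) (f : A →ₙₐ[ℂ] A') (g : B →ₙₐ[ℂ] B')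
    (x : AlgCoprod A B),
    prod (φ ∘ₗ (f : A →ₗ[ℂ] A')) (ψ ∘ₗ (g : B →ₗ[ℂ] B')) x = prod φ ψ (AlgCoprod.map f g x)

/-! ### Dual semigroups -/

/-- The structure of a dual semigroup on a unital star algebra `B`. In the counit laws, `ℂ ⊔₁ B`
and `B ⊔₁ ℂ` are identified with `B`. -/
structure DualSemigroup (B : Type u) [Ring B] [Algebra ℂ B] [StarRing B] [StarModule ℂ B] where
  /-- The comultiplication `Δ : B → B ⊔₁ B`. -/
  comul : B →⋆ₐ[ℂ] UnitalCoprod B B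
  /-- The counit `δ : B → ℂ`. -/
  counit : B →⋆ₐ[ℂ] ℂ
  coassoc : UnitalCoprod.assoc.comp
      ((UnitalCoprod.map comul.toAlgHom (AlgHom.id ℂ B)).comp comul.toAlgHom) =
    (UnitalCoprod.map (AlgHom.id ℂ B) comul.toAlgHom).comp comul.toAlgHom
  counit_left : (UnitalCoprod.lift ((Algebra.ofId ℂ B).comp counit.toAlgHom)
    (AlgHom.id ℂ B)).comp comul.toAlgHom = AlgHom.id ℂ B
  counit_right : (UnitalCoprod.lift (AlgHom.id ℂ B)
    ((Algebra.ofId ℂ B).comp counit.toAlgHom)).comp comul.toAlgHom = AlgHom.id ℂ B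

namespace DualSemigroup

variable {B : Type u} [Ring B] [Algebra ℂ B] [StarRing B] [StarModule ℂ B] (D : DualSemigroup B)

/-- The (non-unital) algebra `B₀ = ker δ`. -/
def aug : NonUnitalSubalgebra ℂ B where
  carrier := {b | D.counit b = 0}
  add_mem' := by
    intro a b ha hb
    simp only [Set.mem_ofPred_eq] at *
    rw [map_add, ha, hb, add_zero]
  zero_mem' := by simp
  mul_mem' := by
    intro a b ha hb
    simp only [Set.mem_ofPred_eq] at *
    rw [map_mul, ha, zero_mul]
  smul_mem' := by
    intro c b hb
    simp only [Set.mem_ofPred_eq] at *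
    rw [map_smul, hb, smul_zero]

/-- The projection `b ↦ b - δ(b)1` of `B = ℂ1 ⊕ B₀` onto `B₀`. -/
def toAug : B →ₗ[ℂ] D.aug where
  toFun b := ⟨b - algebraMap ℂ B (D.counit b), by
    change D.counit (b - algebraMap ℂ B (D.counit b)) = 0
    rw [map_sub, AlgHomClass.commutes]
    simp⟩
  map_add' a b := by
    ext
    simp only [map_add, NonUnitalSubalgebra.coe_add]
    abel
  map_smul' c b := by
    ext
    simp [Algebra.algebraMap_eq_smul_one, smul_sub, mul_smul]

/-- The isomorphism of `B = ℂ1 ⊕ B₀` with the unitization of `B₀`. -/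
def toUnitization : B →ₐ[ℂ] Unitization ℂ D.aug where
  toFun b := Unitization.inl (D.counit b) + Unitization.inr (D.toAug b)
  map_one' := by
    have h : D.toAug 1 = 0 := by
      ext
      change (1 : B) - algebraMap ℂ B (D.counit 1) = 0
      simp
    rw [h, map_one]
    simp
  map_mul' a b := by
    ext
    · simp
    · simp [toAug, Algebra.algebraMap_eq_smul_one, sub_mul, mul_sub, smul_sub, mul_smul]
  map_zero' := by simp
  map_add' a b := by
    ext <;> simp
  commutes' c := by
    have h : D.toAug (algebraMap ℂ B c) = 0 := by
      ext
      change algebraMap ℂ B c - algebraMap ℂ B (D.counit (algebraMap ℂ B c)) = 0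
      rw [AlgHomClass.commutes]
      simp
    rw [h, AlgHomClass.commutes]
    simp [Unitization.algebraMap_eq_inl]

/-- The identification `B ⊔₁ B = ℂ1 ⊕ (B₀ ⊔ B₀)`. -/
def coprodToUnitization : UnitalCoprod B B →ₐ[ℂ] Unitization ℂ (AlgCoprod D.aug D.aug) :=
  UnitalCoprod.lift
    ((Unitization.lift ((Unitization.inrNonUnitalAlgHom ℂ (AlgCoprod D.aug D.aug)).comp
      AlgCoprod.inl)).comp D.toUnitization)
    ((Unitization.lift ((Unitization.inrNonUnitalAlgHom ℂ (AlgCoprod D.aug D.aug)).comp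
      AlgCoprod.inr)).comp D.toUnitization)

/-- The restriction of a linear functional to `B₀`. -/
def restrict (φ : B →ₗ[ℂ] ℂ) : D.aug →ₗ[ℂ] ℂ :=
  φ ∘ₗ (NonUnitalSubalgebraClass.subtype D.aug : D.aug →ₗ[ℂ] B)

/-- The unital extension `c1 + x ↦ c + φ x` of a linear functional to the unitization. -/
def unitExt {A : Type u} [NonUnitalRing A] [Module ℂ A] (φ : A →ₗ[ℂ] ℂ) :
    Unitization ℂ A →ₗ[ℂ] ℂ where
  toFun x := x.fst + φ x.snd
  map_add' x y := by
    simp only [Unitization.fst_add, Unitization.snd_add, map_add]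
    ring
  map_smul' c x := by
    simp only [Unitization.fst_smul, Unitization.snd_smul, map_smul, smul_eq_mul, RingHom.id_apply]
    ring

/-- The convolution `φ ⊎ ψ = (φ ⊙ ψ) ∘ Δ` of normed linear functionals `φ`, `ψ` on `B`. On
`B ⊔₁ B = ℂ1 ⊕ (B₀ ⊔ B₀)` the functional `φ ⊙ ψ` is the normed extension of the product of the
restrictions of `φ` and `ψ` to `B₀`. -/
def uconv (P : Independence.{u}) (φ ψ : B →ₗ[ℂ] ℂ) : B →ₗ[ℂ] ℂ :=
  unitExt (P.prod (D.restrict φ) (D.restrict ψ)) ∘ₗ D.coprodToUnitization.toLinearMap ∘ₗ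
    D.comul.toAlgHom.toLinearMap

/-- The counit as a linear functional. -/
def counitₗ : B →ₗ[ℂ] ℂ := D.counit.toAlgHom.toLinearMap

/-- The convolution product `φ₁ ⊎ ⋯ ⊎ φₙ`; the empty product is the counit. -/
def uconvList (P : Independence.{u}) (l : List (B →ₗ[ℂ] ℂ)) : B →ₗ[ℂ] ℂ :=
  l.foldr (D.uconv P) D.counitₗ

/-- The symmetric tensor algebra `S(B₀)`. -/
def Sym : Type u := SymmetricAlgebra ℂ D.aug

instance : CommRing D.Sym := inferInstanceAs (CommRing (SymmetricAlgebra ℂ D.aug))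

instance : Algebra ℂ D.Sym := inferInstanceAs (Algebra ℂ (SymmetricAlgebra ℂ D.aug))

/-- The canonical embedding of `B₀` into `S(B₀)`. -/
def symι : D.aug →ₗ[ℂ] D.Sym := SymmetricAlgebra.ι ℂ D.aug

/-- The algebra homomorphism on `S(B₀)` extending a linear map on `B₀`. -/
def symLift {A : Type*} [CommRing A] [Algebra ℂ A] (f : D.aug →ₗ[ℂ] A) : D.Sym →ₐ[ℂ] A :=
  SymmetricAlgebra.lift f

@[simp]
theorem symLift_symι {A : Type*} [CommRing A] [Algebra ℂ A] (f : D.aug →ₗ[ℂ] A) (b : D.aug) :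
    D.symLift f (D.symι b) = f b :=
  SymmetricAlgebra.lift_ι_apply f b

/-- The canonical embedding of `B = ℂ1 ⊕ B₀` into `S(B₀)`. -/
def toSym : B →ₗ[ℂ] D.Sym :=
  Algebra.linearMap ℂ D.Sym ∘ₗ D.counitₗ + D.symι ∘ₗ D.toAug

/-- The unital homomorphism `S(φ) : S(B₀) → ℂ` extending the restriction of `φ` to `B₀`, as a
linear functional. -/
def symExt (φ : B →ₗ[ℂ] ℂ) : D.Sym →ₗ[ℂ] ℂ :=
  (D.symLift (D.restrict φ)).toLinearMap

/-- A coalgebra structure on `S(B₀)` is the one determined by `⊙` and `Δ` if it makes `S(B₀)` a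
bialgebra with counit `S(0)`, and `S(φ ⊎ ψ) = S(φ) ∗ S(ψ)` for all normed linear functionals `φ`,
`ψ` on `B`. The product on `WithConv` is the convolution of linear functionals on a coalgebra. -/
structure IsInduced (P : Independence.{u}) [Coalgebra ℂ D.Sym] : Prop where
  comul_one : Coalgebra.comul (R := ℂ) (1 : D.Sym) = 1
  comul_mul : ∀ x y : D.Sym, Coalgebra.comul (R := ℂ) (x * y) =
    Coalgebra.comul (R := ℂ) x * Coalgebra.comul (R := ℂ) y
  counit_eq : (Coalgebra.counit : D.Sym →ₗ[ℂ] ℂ) = D.symExt 0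
  symExt_uconv : ∀ φ ψ : B →ₗ[ℂ] ℂ, φ 1 = 1 → ψ 1 = 1 →
    WithConv.toConv (D.symExt (D.uconv P φ ψ)) =
      WithConv.toConv (D.symExt φ) * WithConv.toConv (D.symExt ψ)

/-- The functional `D(Ψ)` on `S(B₀)` which is `Ψ` on `B₀` and zero on all other symmetric powers,
see `degreeOne_symι` and `degreeOne_prod`. -/
def degreeOne (Ψ : B →ₗ[ℂ] ℂ) : D.Sym →ₗ[ℂ] ℂ :=
  TrivSqZeroExt.sndHom ℂ ℂ ∘ₗ
    (D.symLift (TrivSqZeroExt.inrHom ℂ ℂ ∘ₗ D.restrict Ψ)).toLinearMap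

theorem degreeOne_symι (Ψ : B →ₗ[ℂ] ℂ) (b : D.aug) : D.degreeOne Ψ (D.symι b) = Ψ b := by
  simp [degreeOne, restrict]

theorem degreeOne_prod (Ψ : B →ₗ[ℂ] ℂ) (l : List D.aug) (hl : l.length ≠ 1) :
    D.degreeOne Ψ (l.map D.symι).prod = 0 := by
  match l with
  | [] => simp [degreeOne]
  | [_] => simp at hl
  | a :: b :: l =>
    simp only [degreeOne, List.map_cons, List.prod_cons, LinearMap.comp_apply,
      AlgHom.toLinearMap_apply, map_mul, symLift_symι, ← mul_assoc]
    simp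

end DualSemigroup

/-- The functional `exp_∗(F) = ∑ₙ F^{∗n} / n!` on a coalgebra, defined pointwise. -/
def convExp {C : Type u} [AddCommMonoid C] [Module ℂ C] [Coalgebra ℂ C] (F : C →ₗ[ℂ] ℂ)
    (c : C) : ℂ :=
  ∑' n : ℕ, ((n.factorial : ℂ))⁻¹ * (WithConv.toConv F ^ n) c

/-! ### Partitions of an interval -/

/-- The partitions of the interval `[S, T]`: finite subsets which contain both endpoints, ordered
by inclusion. -/
def IntervalPartition (S T : ℝ) : Type :=
  {α : Finset ℝ // S ∈ α ∧ T ∈ α ∧ (α : Set ℝ) ⊆ Set.Icc S T}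

namespace IntervalPartition

instance (S T : ℝ) : PartialOrder (IntervalPartition S T) :=
  inferInstanceAs (PartialOrder {α : Finset ℝ // S ∈ α ∧ T ∈ α ∧ (α : Set ℝ) ⊆ Set.Icc S T})

instance (S T : ℝ) : IsDirectedOrder (IntervalPartition S T) where
  directed := by
    rintro ⟨α, h1, h2, h3⟩ ⟨β, h4, h5, h6⟩
    refine ⟨⟨α ∪ β, Finset.mem_union_left _ h1, Finset.mem_union_left _ h2, ?_⟩, ?_, ?_⟩
    · rw [Finset.coe_union]
      exact Set.union_subset h3 h6
    · exact Finset.subset_union_left (s₁ := α) (s₂ := β)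
    · exact Finset.subset_union_right (s₁ := α) (s₂ := β)

/-- The list `t₂ - t₁, …, tₙ - tₙ₋₁` for the partition `S = t₁ < ⋯ < tₙ = T`. -/
def steps {S T : ℝ} (α : IntervalPartition S T) : List ℝ :=
  List.zipWith (fun s t => t - s) (α.1.sort (· ≤ ·)) (α.1.sort (· ≤ ·)).tail

end IntervalPartition

end

/-! The heart of the matter is that a natural product is polynomial: for fixed `x` in `A ⊔ B`, the
number `(φ ⊙ ψ)(x)` is a polynomial in finitely many values of `φ` and of `ψ`. One may take `x` to
be a monomial in which every variable occurs once, so that its value is multilinear in the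
variables. Naturality allows the variables of one factor to be free generators. Each generator is
then split into a sum of labelled copies, and `φ` is lifted to a functional that lives on a single
labelling of every word. Multilinearity gives a sum over the choices `c` of one label per generator.
The labelling is such that, for fixed `c`, the lifted functional sees only words without repetitions
which pairwise share no letter; rescaling generators therefore pulls out the values of `φ` on these
words as scalars, and a universal coefficient remains (`MomentFunctional.toFun_eq_sum`). Doing this
for both factors, `(φ ⊙ ψ)(x)` is `S(φ) ⊗ S(ψ)` applied to an element of `S(A) ⊗ S(B)`, which is
unique because characters separate points (`exists_symTensor_eq_prod`, `symTensor_ext`).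

For `A = B = B₀`, composing this linear map with `Δ` on `B₀` and extending multiplicatively gives
the comultiplication of `S(B₀)`. Its laws can be tested on characters, where they become
associativity of `⊎` on `B₀` and the fact that the zero functional is its unit (`symPair_symComul`).

For the limit, any coalgebra structure with the required properties will do. An element of a
coalgebra lies in a finite dimensional subcomodule, so convolution of functionals is represented by
matrices whose entries are values of the functionals (`exists_matrix_rep`). The matrices of `S(k_t)`
are `1` at `t = 0` and have as right derivative there the matrix `X` of `D(Ψ)`, because `D(Ψ)`
satisfies the Leibniz rule relative to `S(0)`. Products of such matrices along partitions of small
mesh approach `exp((T - S)X)` by a telescoping estimate (`exists_norm_prod_sub_exp_le`), and the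
mesh becomes small along the net (`eventually_steps_le`). -/

noncomputable section

/-! ### Functionals on free algebras -/

namespace FreeAlgebra

/-- The monomial of the free algebra given by a word. -/
def word {X : Type*} (w : List X) : FreeAlgebra ℂ X := (w.map (FreeAlgebra.ι ℂ)).prod

theorem basisFreeMonoid_apply {X : Type*} (w : FreeMonoid X) :
    FreeAlgebra.basisFreeMonoid ℂ X w = word w.toList := by
  simp [FreeAlgebra.basisFreeMonoid, FreeAlgebra.equivMonoidAlgebraFreeMonoid, word,
    FreeMonoid.lift_apply]

/-- The linear functional on the free algebra with prescribed values on words. -/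
def wordFunctional {X : Type*} (f : List X → ℂ) : FreeAlgebra ℂ X →ₗ[ℂ] ℂ :=
  (FreeAlgebra.basisFreeMonoid ℂ X).constr ℂ fun w => f w.toList

theorem wordFunctional_word {X : Type*} (f : List X → ℂ) (w : List X) :
    wordFunctional f (word w) = f w := by
  have h := basisFreeMonoid_apply (FreeMonoid.ofList w)
  rw [FreeMonoid.toList_ofList] at h
  rw [← h, wordFunctional, Module.Basis.constr_basis, FreeMonoid.toList_ofList]

theorem linearMap_ext_word {X : Type*} {M : Type*} [AddCommMonoid M] [Module ℂ M]
    {f g : FreeAlgebra ℂ X →ₗ[ℂ] M} (h : ∀ w, f (word w) = g (word w)) : f = g := by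
  refine (FreeAlgebra.basisFreeMonoid ℂ X).ext fun w => ?_
  rw [basisFreeMonoid_apply, h]

theorem lift_word {X : Type*} {A : Type*} [Ring A] [Algebra ℂ A] (a : X → A) (w : List X) :
    FreeAlgebra.lift ℂ a (word w) = (w.map a).prod := by
  simp [word, map_list_prod, List.map_map, Function.comp_def]

/-- Rescaling generators acts diagonally on monomials; this is what lets naturality pull values of a
functional out as scalars. -/
theorem lift_smul_word {X : Type*} (r : X → ℂ) (w : List X) :
    FreeAlgebra.lift ℂ (fun x => r x • FreeAlgebra.ι ℂ x) (word w) =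
      (w.map r).prod • word w := by
  rw [lift_word]
  induction w with
  | nil => simp [word]
  | cons x t ih => simp only [List.map_cons, List.prod_cons, ih, word, smul_mul_smul_comm]

theorem wordFunctional_ι_mul {X : Type*} (f : List X → ℂ) (x : X) (y : FreeAlgebra ℂ X) :
    wordFunctional f (FreeAlgebra.ι ℂ x * y) = wordFunctional (fun w => f (x :: w)) y := by
  have h : wordFunctional f ∘ₗ LinearMap.mulLeft ℂ (FreeAlgebra.ι ℂ x) =
      wordFunctional (fun w => f (x :: w)) := by
    refine linearMap_ext_word fun w => ?_
    rw [LinearMap.comp_apply, LinearMap.mulLeft_apply, wordFunctional_word,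
      ← wordFunctional_word f]
    simp [word]
  exact LinearMap.congr_fun h y

/-- If a functional vanishes on all labellings of a word but one, its value on the product of the
sums of the labelled letters is its value on this labelling. -/
theorem wordFunctional_lift_sum {X J : Type*} [Fintype J] (w : List X) :
    ∀ (f : List (X × J) → ℂ) (v₀ : List (X × J)), v₀.map Prod.fst = w →
      (∀ v, v.map Prod.fst = w → v ≠ v₀ → f v = 0) →
      wordFunctional f (FreeAlgebra.lift ℂ (fun x => ∑ j : J, FreeAlgebra.ι ℂ (x, j)) (word w)) =
        f v₀ := by
  classical
  induction w with
  | nil =>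
    intro f v₀ h _
    rw [List.map_eq_nil_iff] at h
    subst h
    have h := wordFunctional_word f []
    simpa [word] using h
  | cons x t ih =>
    intro f v₀ h h0
    match v₀, h with
    | p :: v₁, h =>
      obtain ⟨x', j₀⟩ := p
      simp only [List.map_cons, List.cons.injEq] at h
      obtain ⟨rfl, h1⟩ := h
      rw [lift_word, List.map_cons, List.prod_cons, Finset.sum_mul, map_sum, ← lift_word]
      simp only [wordFunctional_ι_mul]
      rw [Finset.sum_eq_single j₀]
      · exact ih _ v₁ h1 fun v hv hne => h0 _ (by simp [hv]) (by simpa using hne)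
      -- For a wrong first label the functional vanishes on every labelling of the tail, so the
      -- induction hypothesis applies with any distinguished labelling; `v₁` serves again.
      · intro j _ hj
        have hz : ∀ v, v.map Prod.fst = t → f ((x', j) :: v) = 0 := fun v hv =>
          h0 _ (by simp [hv]) (by simp [hj])
        rw [ih _ v₁ h1 fun v hv _ => hz v hv, hz v₁ h1]
      · simp

end FreeAlgebra

/-! ### Labelled words -/

namespace MomentFunctional

/-- The labels of letters: words without repetitions. -/
abbrev Label (ι : Type u) : Type u := {l : List ι // l.Nodup}

/-- A labelling of words which gives different labels to the last and to any earlier occurrence of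
a letter. -/
def splitLabel {ι : Type u} [DecidableEq ι] : List ι → List (ι × Label ι)
  | [] => []
  | i :: t => (i, if i ∈ t then ⟨[], List.nodup_nil⟩ else ⟨[i], List.nodup_singleton i⟩) ::
      splitLabel t

theorem map_fst_splitLabel {ι : Type u} [DecidableEq ι] (w : List ι) :
    (splitLabel w).map Prod.fst = w := by
  induction w with
  | nil => rfl
  | cons i t ih => simp [splitLabel, ih]

/-- The last occurrence of a letter is followed by no further one, so it carries the singleton
label. -/
theorem mem_splitLabel {ι : Type u} [DecidableEq ι] {i : ι} {w : List ι} (h : i ∈ w) :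
    (i, (⟨[i], List.nodup_singleton i⟩ : Label ι)) ∈ splitLabel w := by
  induction w with
  | nil => simp at h
  | cons k t ih =>
    by_cases hi : i ∈ t
    · exact List.mem_cons_of_mem _ (ih hi)
    · obtain rfl : i = k := by simpa [hi] using h
      simp [splitLabel, hi]

/-- A repeated letter would carry the empty label at an earlier occurrence and a singleton label at
the last, which no function of the letter can achieve. -/
theorem nodup_of_splitLabel_eq {ι : Type u} [DecidableEq ι] (c : ι → Label ι) {w : List ι}
    (h : splitLabel w = w.map fun i => (i, c i)) : w.Nodup := by
  induction w with
  | nil => exact List.nodup_nil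
  | cons i t ih =>
    simp only [splitLabel, List.map_cons, List.cons.injEq, Prod.mk.injEq, true_and] at h
    refine List.nodup_cons.2 ⟨fun hi => ?_, ih h.2⟩
    have h1 := mem_splitLabel hi
    rw [h.2, List.mem_map] at h1
    obtain ⟨k, _, hk⟩ := h1
    rw [Prod.mk.injEq] at hk
    obtain ⟨rfl, hk⟩ := hk
    rw [if_pos hi, hk] at h
    simp at h

/-- A labelling of words such that words without repetitions are labelled by themselves, and no
word with repetitions is labelled by a function of its letters. -/
def labelling {ι : Type u} [DecidableEq ι] (w : List ι) : List (ι × Label ι) :=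
  if h : w.Nodup then w.map fun i => (i, ⟨w, h⟩) else splitLabel w

theorem map_fst_labelling {ι : Type u} [DecidableEq ι] (w : List ι) :
    (labelling w).map Prod.fst = w := by
  unfold labelling
  split_ifs
  · simp [Function.comp_def]
  · exact map_fst_splitLabel w

/-- Consequence: for fixed `c`, the nonempty words whose labelling comes from `c` have no
repetitions, and two of them with a common letter `i` both equal `c i`. Their letter sets are
therefore disjoint. -/
theorem labelling_eq_iff {ι : Type u} [DecidableEq ι] (c : ι → Label ι) (w : List ι) :
    (w.map fun i => (i, c i)) = labelling w ↔ ∀ i ∈ w, (c i).1 = w := by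
  unfold labelling
  split_ifs with h
  · rw [List.map_inj_left]
    simp [Subtype.ext_iff]
  · constructor
    · intro h1
      exact absurd (nodup_of_splitLabel_eq c h1.symm) h
    · intro h1
      cases w with
      | nil => simp at h
      | cons i t => exact absurd (h1 i (by simp) ▸ (c i).2) h

end MomentFunctional

/-! ### Natural multilinear functions of functionals are polynomial -/

/-- A family of multilinear functions of tuples in an algebra, indexed by the linear functionals
on algebras, which is natural with respect to algebra homomorphisms. -/
structure MomentFunctional (ι : Type u) where
  /-- The multilinear function which belongs to a functional. -/
  toFun : ∀ {A : Type u} [NonUnitalRing A] [Module ℂ A] [IsScalarTower ℂ A A]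
    [SMulCommClass ℂ A A], (A →ₗ[ℂ] ℂ) → MultilinearMap ℂ (fun _ : ι => A) ℂ
  natural : ∀ {A A' : Type u} [NonUnitalRing A] [Module ℂ A] [IsScalarTower ℂ A A]
    [SMulCommClass ℂ A A] [NonUnitalRing A'] [Module ℂ A'] [IsScalarTower ℂ A' A']
    [SMulCommClass ℂ A' A'] (φ : A' →ₗ[ℂ] ℂ) (f : A →ₙₐ[ℂ] A') (a : ι → A),
    toFun (φ ∘ₗ (f : A →ₗ[ℂ] A')) a = toFun φ (fun i => f (a i))

namespace MomentFunctional

open FreeAlgebra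

theorem natural_algHom {ι : Type u} (Γ : MomentFunctional ι) {A A' : Type u} [Ring A]
    [Algebra ℂ A] [Ring A'] [Algebra ℂ A'] (φ : A' →ₗ[ℂ] ℂ) (f : A →ₐ[ℂ] A') (a : ι → A) :
    Γ.toFun (φ ∘ₗ f.toLinearMap) a = Γ.toFun φ fun i => f (a i) :=
  Γ.natural φ (f : A →ₙₐ[ℂ] A') a

variable {ι : Type u} [Fintype ι] [DecidableEq ι]

/-- The functional on the free algebra which is `1` on the words which are the common label of all
their letters, and zero on all other words. -/
def blockFunctional (c : ι → Label ι) : FreeAlgebra ℂ ι →ₗ[ℂ] ℂ :=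
  wordFunctional fun w => if w ≠ [] ∧ ∀ i ∈ w, (c i).1 = w then 1 else 0

/-- The factor `φ(l)` if `i` is the first letter of `l`, and `1` otherwise. -/
def headFactor {M : Type*} [One M] (m : List ι → M) (i : ι) (l : List ι) : M :=
  if l.head? = some i then m l else 1

/-- Without repetitions exactly one letter of the word is its head, so the value is counted once. -/
theorem prod_map_headFactor (m : List ι → ℂ) {w : List ι} (hw : w ≠ []) (h : w.Nodup) :
    (w.map fun i => headFactor m i w).prod = m w := by
  match w, hw with
  | i :: t, _ =>
    rw [List.map_cons, List.prod_cons, List.prod_eq_one]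
    · simp [headFactor]
    · intro x hx
      obtain ⟨k, hk, rfl⟩ := List.mem_map.1 hx
      have : i ≠ k := fun e => (List.nodup_cons.1 h).1 (e ▸ hk)
      simp [headFactor, this]

/-- The coefficients do not involve `φ`, so this is a polynomial in the values of `φ` on words
without repetitions. -/
theorem toFun_freeAlgebra (Γ : MomentFunctional ι) (φ : FreeAlgebra ℂ ι →ₗ[ℂ] ℂ) (h1 : φ 1 = 0) :
    Γ.toFun φ (FreeAlgebra.ι ℂ) = ∑ c : ι → Label ι,
      Γ.toFun (blockFunctional c) (FreeAlgebra.ι ℂ) *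
        ∏ i, headFactor (fun l => φ (word l)) i (c i).1 := by
  -- Each word carries the whole value of `φ` on its one chosen labelling; summing over all labels
  -- recovers `φ`.
  let g : List (ι × Label ι) → ℂ := fun v =>
    if v = labelling (v.map Prod.fst) then φ (word (v.map Prod.fst)) else 0
  let h : FreeAlgebra ℂ ι →ₐ[ℂ] FreeAlgebra ℂ (ι × Label ι) :=
    FreeAlgebra.lift ℂ fun i => ∑ j : Label ι, FreeAlgebra.ι ℂ (i, j)
  have hφ : φ = wordFunctional g ∘ₗ h.toLinearMap := by
    refine linearMap_ext_word fun w => ?_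
    have := wordFunctional_lift_sum w g (labelling w) (map_fst_labelling w) ?_
    · refine Eq.trans ?_ this.symm
      simp [g, map_fst_labelling]
    · rintro v rfl hv
      simp [g, hv]
  have e1 : Γ.toFun φ (FreeAlgebra.ι ℂ) =
      Γ.toFun (wordFunctional g) fun i => ∑ j : Label ι, FreeAlgebra.ι ℂ (i, j) := by
    conv_lhs => rw [hφ, Γ.natural_algHom]
    congr 1
    funext i
    simp [h]
  rw [e1, MultilinearMap.map_sum]
  refine Finset.sum_congr rfl fun c _ => ?_
  let p : FreeAlgebra ℂ ι →ₐ[ℂ] FreeAlgebra ℂ (ι × Label ι) :=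
    FreeAlgebra.lift ℂ fun i => FreeAlgebra.ι ℂ (i, c i)
  -- The value of `φ` on a block is carried by the first letter of this block; all other letters
  -- keep the factor `1`.
  let s : FreeAlgebra ℂ ι →ₐ[ℂ] FreeAlgebra ℂ ι :=
    FreeAlgebra.lift ℂ fun i => headFactor (fun l => φ (word l)) i (c i).1 • FreeAlgebra.ι ℂ i
  have e2 : wordFunctional g ∘ₗ p.toLinearMap =
      blockFunctional c ∘ₗ s.toLinearMap := by
    refine linearMap_ext_word fun w => ?_
    have hp : p (word w) = word (w.map fun i => (i, c i)) := by
      simp only [p, lift_word]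
      simp [word, Function.comp_def]
    have hs : s (word w) =
        (w.map fun i => headFactor (fun l => φ (word l)) i (c i).1).prod • word w := by
      exact lift_smul_word _ w
    change wordFunctional g (p (word w)) = blockFunctional c (s (word w))
    rw [hp, hs, map_smul, blockFunctional, wordFunctional_word, wordFunctional_word]
    have hm : (w.map fun i => (i, c i)).map Prod.fst = w := by simp [Function.comp_def]
    simp only [g, hm, labelling_eq_iff]
    -- The empty word satisfies the label condition vacuously, so it is excluded from
    -- `blockFunctional` and needs `φ 1 = 0`.
    by_cases hw : w = []
    · subst hw
      simpa [word] using h1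
    · by_cases hc : ∀ i ∈ w, (c i).1 = w
      · have : (w.map fun i => headFactor (fun l => φ (word l)) i (c i).1) =
            w.map fun i => headFactor (fun l => φ (word l)) i w :=
          List.map_congr_left fun i hi => by rw [hc i hi]
        have hn : w.Nodup := by
          obtain ⟨i, hi⟩ := List.exists_mem_of_ne_nil w hw
          exact hc i hi ▸ (c i).2
        rw [this, prod_map_headFactor _ hw hn, if_pos hc, if_pos ⟨hw, hc⟩]
        simp
      · simp [hc]
  have e3 : (Γ.toFun (wordFunctional g) fun i => FreeAlgebra.ι ℂ (i, c i)) =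
      Γ.toFun (blockFunctional c) fun i =>
        headFactor (fun l => φ (word l)) i (c i).1 • FreeAlgebra.ι ℂ i := by
    have h2 := Γ.natural_algHom (wordFunctional g) p (FreeAlgebra.ι ℂ)
    rw [e2, Γ.natural_algHom] at h2
    simpa [p, s] using h2.symm
  rw [e3, MultilinearMap.map_smul_univ, smul_eq_mul, mul_comm]

/-- The product of the entries of a tuple in a not necessarily unital algebra along a word, with
value `0` for the empty word. -/
def wordProd {A : Type*} [NonUnitalRing A] [Module ℂ A] [IsScalarTower ℂ A A]
    [SMulCommClass ℂ A A] (a : ι → A) (l : List ι) : A :=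
  ((l.map fun i => (Unitization.inr (a i) : Unitization ℂ A)).prod).snd

/-- Naturality along the map of the free algebra into the unitization reduces to free generators.
Extending `φ` by zero on the unit secures the normalization required by `toFun_freeAlgebra`. -/
theorem toFun_eq_sum (Γ : MomentFunctional ι) {A : Type u} [NonUnitalRing A] [Module ℂ A]
    [IsScalarTower ℂ A A] [SMulCommClass ℂ A A] (φ : A →ₗ[ℂ] ℂ) (a : ι → A) :
    Γ.toFun φ a = ∑ c : ι → Label ι, Γ.toFun (blockFunctional c) (FreeAlgebra.ι ℂ) *
        ∏ i, headFactor (fun l => φ (wordProd a l)) i (c i).1 := by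
  let φ' : Unitization ℂ A →ₗ[ℂ] ℂ := φ ∘ₗ Unitization.sndHom ℂ ℂ A
  let h : FreeAlgebra ℂ ι →ₐ[ℂ] Unitization ℂ A :=
    FreeAlgebra.lift ℂ fun i => (Unitization.inr (a i) : Unitization ℂ A)
  have e1 : Γ.toFun φ a = Γ.toFun φ' fun i => (Unitization.inr (a i) : Unitization ℂ A) := by
    have h1 : φ = φ' ∘ₗ (Unitization.inrNonUnitalAlgHom ℂ A : A →ₗ[ℂ] Unitization ℂ A) := by
      ext x
      simp [φ']
    conv_lhs => rw [h1, Γ.natural]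
    rfl
  have e2 : (Γ.toFun φ' fun i => (Unitization.inr (a i) : Unitization ℂ A)) =
      Γ.toFun (φ' ∘ₗ h.toLinearMap)
        (FreeAlgebra.ι ℂ) := by
    rw [Γ.natural_algHom]
    congr 1
    funext i
    simp [h]
  rw [e1, e2, toFun_freeAlgebra]
  · refine Finset.sum_congr rfl fun c _ => ?_
    congr 2
    funext i
    congr 1
    funext l
    change φ' (h (word l)) = _
    rw [lift_word]
    rfl
  · simp [φ']

end MomentFunctional
end

noncomputable section

open scoped TensorProduct

/-! ### Words in a free product -/

/-- A monomial in two families of variables with values in the left and in the right factor of a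
free product, each variable occurring once: a natural function which is linear in each variable. -/
structure WordTemplate (ι κ : Type u) where
  /-- The value of the monomial. -/
  toFun : ∀ {A B : Type u} [NonUnitalRing A] [Module ℂ A] [IsScalarTower ℂ A A]
    [SMulCommClass ℂ A A] [NonUnitalRing B] [Module ℂ B] [IsScalarTower ℂ B B]
    [SMulCommClass ℂ B B], (ι → A) → (κ → B) → AlgCoprod A B
  natural : ∀ {A A' B B' : Type u} [NonUnitalRing A] [Module ℂ A] [IsScalarTower ℂ A A]
    [SMulCommClass ℂ A A] [NonUnitalRing B] [Module ℂ B] [IsScalarTower ℂ B B]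
    [SMulCommClass ℂ B B] [NonUnitalRing A'] [Module ℂ A'] [IsScalarTower ℂ A' A']
    [SMulCommClass ℂ A' A'] [NonUnitalRing B'] [Module ℂ B'] [IsScalarTower ℂ B' B']
    [SMulCommClass ℂ B' B'] (f : A →ₙₐ[ℂ] A') (g : B →ₙₐ[ℂ] B') (a : ι → A) (b : κ → B),
    AlgCoprod.map f g (toFun a b) = toFun (fun i => f (a i)) (fun j => g (b j))
  update_add_left : ∀ {A B : Type u} [NonUnitalRing A] [Module ℂ A] [IsScalarTower ℂ A A]
    [SMulCommClass ℂ A A] [NonUnitalRing B] [Module ℂ B] [IsScalarTower ℂ B B]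
    [SMulCommClass ℂ B B] [DecidableEq ι] (a : ι → A) (b : κ → B) (i : ι) (x y : A),
    toFun (Function.update a i (x + y)) b =
      toFun (Function.update a i x) b + toFun (Function.update a i y) b
  update_smul_left : ∀ {A B : Type u} [NonUnitalRing A] [Module ℂ A] [IsScalarTower ℂ A A]
    [SMulCommClass ℂ A A] [NonUnitalRing B] [Module ℂ B] [IsScalarTower ℂ B B]
    [SMulCommClass ℂ B B] [DecidableEq ι] (a : ι → A) (b : κ → B) (i : ι) (r : ℂ) (x : A),
    toFun (Function.update a i (r • x)) b = r • toFun (Function.update a i x) b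
  update_add_right : ∀ {A B : Type u} [NonUnitalRing A] [Module ℂ A] [IsScalarTower ℂ A A]
    [SMulCommClass ℂ A A] [NonUnitalRing B] [Module ℂ B] [IsScalarTower ℂ B B]
    [SMulCommClass ℂ B B] [DecidableEq κ] (a : ι → A) (b : κ → B) (j : κ) (x y : B),
    toFun a (Function.update b j (x + y)) =
      toFun a (Function.update b j x) + toFun a (Function.update b j y)
  update_smul_right : ∀ {A B : Type u} [NonUnitalRing A] [Module ℂ A] [IsScalarTower ℂ A A]
    [SMulCommClass ℂ A A] [NonUnitalRing B] [Module ℂ B] [IsScalarTower ℂ B B]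
    [SMulCommClass ℂ B B] [DecidableEq κ] (a : ι → A) (b : κ → B) (j : κ) (r : ℂ) (x : B),
    toFun a (Function.update b j (r • x)) = r • toFun a (Function.update b j x)

namespace WordTemplate

theorem map_inl {A A' B B' : Type*} [NonUnitalRing A] [Module ℂ A] [IsScalarTower ℂ A A]
    [SMulCommClass ℂ A A] [NonUnitalRing B] [Module ℂ B] [IsScalarTower ℂ B B]
    [SMulCommClass ℂ B B] [NonUnitalRing A'] [Module ℂ A'] [IsScalarTower ℂ A' A']
    [SMulCommClass ℂ A' A'] [NonUnitalRing B'] [Module ℂ B'] [IsScalarTower ℂ B' B']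
    [SMulCommClass ℂ B' B'] (f : A →ₙₐ[ℂ] A') (g : B →ₙₐ[ℂ] B') (a : A) :
    AlgCoprod.map f g (AlgCoprod.inl a) = AlgCoprod.inl (f a) := by
  simp [AlgCoprod.map]

theorem map_inr {A A' B B' : Type*} [NonUnitalRing A] [Module ℂ A] [IsScalarTower ℂ A A]
    [SMulCommClass ℂ A A] [NonUnitalRing B] [Module ℂ B] [IsScalarTower ℂ B B]
    [SMulCommClass ℂ B B] [NonUnitalRing A'] [Module ℂ A'] [IsScalarTower ℂ A' A']
    [SMulCommClass ℂ A' A'] [NonUnitalRing B'] [Module ℂ B'] [IsScalarTower ℂ B' B']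
    [SMulCommClass ℂ B' B'] (f : A →ₙₐ[ℂ] A') (g : B →ₙₐ[ℂ] B') (b : B) :
    AlgCoprod.map f g (AlgCoprod.inr b) = AlgCoprod.inr (g b) := by
  simp [AlgCoprod.map]

/-- The monomial which is a variable of the left factor. -/
def left : WordTemplate PUnit.{u + 1} PEmpty.{u + 1} where
  toFun a _ := AlgCoprod.inl (a PUnit.unit)
  natural f g a b := map_inl f g _
  update_add_left := by simp
  update_smul_left := by simp
  update_add_right _ _ j := j.elim
  update_smul_right _ _ j := j.elim

/-- The monomial which is a variable of the right factor. -/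
def right : WordTemplate PEmpty.{u + 1} PUnit.{u + 1} where
  toFun _ b := AlgCoprod.inr (b PUnit.unit)
  natural f g a b := map_inr f g _
  update_add_left _ _ j := j.elim
  update_smul_left _ _ j := j.elim
  update_add_right := by simp
  update_smul_right := by simp

/-- The product of two monomials in disjoint variables. -/
def mul {ι ι' κ κ' : Type u} (W : WordTemplate ι κ) (W' : WordTemplate ι' κ') :
    WordTemplate (ι ⊕ ι') (κ ⊕ κ') where
  toFun a b := W.toFun (fun i => a (Sum.inl i)) (fun j => b (Sum.inl j)) *
    W'.toFun (fun i => a (Sum.inr i)) (fun j => b (Sum.inr j))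
  natural f g a b := by rw [map_mul, W.natural, W'.natural]
  update_add_left a b i x y := by
    classical
    cases i
    · simp [W.update_add_left, add_mul]
    · simp [W'.update_add_left, mul_add]
  update_smul_left a b i r x := by
    classical
    cases i
    · simp [W.update_smul_left, smul_mul_assoc]
    · simp [W'.update_smul_left, mul_smul_comm]
  update_add_right a b i x y := by
    classical
    cases i
    · simp [W.update_add_right, add_mul]
    · simp [W'.update_add_right, mul_add]
  update_smul_right a b i r x := by
    classical
    cases i
    · simp [W.update_smul_right, smul_mul_assoc]
    · simp [W'.update_smul_right, mul_smul_comm]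

section Independence

variable {A B : Type u} [NonUnitalRing A] [Module ℂ A] [IsScalarTower ℂ A A] [SMulCommClass ℂ A A]
  [NonUnitalRing B] [Module ℂ B] [IsScalarTower ℂ B B] [SMulCommClass ℂ B B]

/-- The values of all monomials. -/
def values (A B : Type u) [NonUnitalRing A] [Module ℂ A] [IsScalarTower ℂ A A]
    [SMulCommClass ℂ A A] [NonUnitalRing B] [Module ℂ B] [IsScalarTower ℂ B B]
    [SMulCommClass ℂ B B] : Set (AlgCoprod A B) :=
  {x | ∃ (ι κ : Type u) (_ : Fintype ι) (_ : Fintype κ) (W : WordTemplate ι κ) (a : ι → A)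
    (b : κ → B), W.toFun a b = x}

/-- The free product is spanned by the values of monomials. -/
theorem span_values : Submodule.span ℂ (values A B) = ⊤ := by
  refine Submodule.eq_top_iff'.2 fun x => ?_
  induction x using AlgCoprod.induction with
  | hl a =>
    exact Submodule.subset_span ⟨PUnit, PEmpty, inferInstance, inferInstance, left, fun _ => a,
      fun j => j.elim, rfl⟩
  | hr b =>
    exact Submodule.subset_span ⟨PEmpty, PUnit, inferInstance, inferInstance, right,
      fun j => j.elim, fun _ => b, rfl⟩
  | hadd x y h1 h2 => exact add_mem h1 h2
  | hzero => exact zero_mem _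
  | hsmul c x h => exact Submodule.smul_mem _ c h
  | hmul x y h1 h2 =>
    induction h1 using Submodule.span_induction with
    | zero => simp
    | add u v _ _ hu hv => rw [add_mul]; exact add_mem hu hv
    | smul c u _ hu => rw [smul_mul_assoc]; exact Submodule.smul_mem _ c hu
    | mem u hu =>
      induction h2 using Submodule.span_induction with
      | zero => simp
      | add u v _ _ hu hv => rw [mul_add]; exact add_mem hu hv
      | smul c u _ hu => rw [mul_smul_comm]; exact Submodule.smul_mem _ c hu
      | mem v hv =>
        obtain ⟨ι, κ, _, _, W, a, b, rfl⟩ := hu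
        obtain ⟨ι', κ', _, _, W', a', b', rfl⟩ := hv
        exact Submodule.subset_span ⟨ι ⊕ ι', κ ⊕ κ', inferInstance, inferInstance, W.mul W',
          Sum.elim a a', Sum.elim b b', rfl⟩

variable (P : Independence.{u})

/-- The product of functionals at a monomial, as a function of the functional and the variables on
the left factor. -/
def leftMoment {ι κ : Type u} (W : WordTemplate ι κ) (ψ : B →ₗ[ℂ] ℂ) (b : κ → B) :
    MomentFunctional ι where
  toFun φ :=
    { toFun := fun a => P.prod φ ψ (W.toFun a b)
      map_update_add' := fun a i x y => by rw [W.update_add_left, map_add]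
      map_update_smul' := fun a i r x => by rw [W.update_smul_left, map_smul] }
  natural φ f a := by
    have h := P.prod_comp φ ψ f (NonUnitalAlgHom.id ℂ B) (W.toFun a b)
    rw [W.natural] at h
    exact h

/-- The product of functionals at a monomial, as a function of the functional and the variables on
the right factor. -/
def rightMoment {ι κ : Type u} (W : WordTemplate ι κ) (φ : A →ₗ[ℂ] ℂ) (a : ι → A) :
    MomentFunctional κ where
  toFun ψ :=
    { toFun := fun b => P.prod φ ψ (W.toFun a b)
      map_update_add' := fun a i x y => by rw [W.update_add_right, map_add]
      map_update_smul' := fun a i r x => by rw [W.update_smul_right, map_smul] }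
  natural ψ g b := by
    have h := P.prod_comp φ ψ (NonUnitalAlgHom.id ℂ A) g (W.toFun a b)
    rw [W.natural] at h
    exact h

end Independence

end WordTemplate

/-! ### The product of functionals as an element of a tensor product of symmetric algebras -/

namespace SymmetricAlgebra

/-- The characters of a symmetric algebra separate points. -/
theorem eq_zero_of_lift_eq_zero {V : Type*} [AddCommGroup V] [Module ℂ V]
    {s : SymmetricAlgebra ℂ V} (h : ∀ φ : V →ₗ[ℂ] ℂ, SymmetricAlgebra.lift φ s = 0) : s = 0 := by
  let b := Module.Basis.ofVectorSpace ℂ V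
  refine (SymmetricAlgebra.equivMvPolynomial b).injective ?_
  rw [map_zero]
  refine MvPolynomial.funext fun x => ?_
  -- Points of the polynomial ring are characters, and a polynomial over an infinite field that
  -- vanishes at all points is zero.
  have e : ((MvPolynomial.aeval x).comp (SymmetricAlgebra.equivMvPolynomial b).toAlgHom :
      SymmetricAlgebra ℂ V →ₐ[ℂ] ℂ) = SymmetricAlgebra.lift (b.constr ℂ x) := by
    refine SymmetricAlgebra.algHom_ext (b.ext fun i => ?_)
    simp
  have := (DFunLike.congr_fun e s).trans (h _)
  simpa [MvPolynomial.aeval_eq_eval] using this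

end SymmetricAlgebra

/-- If families of functionals separate the points of two vector spaces, then their tensor
products separate the points of the tensor product. -/
theorem TensorProduct.eq_zero_of_map_eq_zero {V W I J : Type*} [AddCommGroup V] [Module ℂ V]
    [AddCommGroup W] [Module ℂ W] (f : I → V →ₗ[ℂ] ℂ) (g : J → W →ₗ[ℂ] ℂ)
    (hf : ∀ v, (∀ i, f i v = 0) → v = 0) (hg : ∀ w, (∀ j, g j w = 0) → w = 0) (s : V ⊗[ℂ] W)
    (h : ∀ i j, LinearMap.mul' ℂ ℂ (TensorProduct.map (f i) (g j) s) = 0) : s = 0 := by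
  classical
  let e := Module.Basis.ofVectorSpace ℂ W
  -- Contracting the left leg with `f i` leaves a vector of `W` killed by all `g j`.
  have h1 : ∀ i, TensorProduct.lid ℂ W (LinearMap.rTensor W (f i) s) = 0 := by
    intro i
    refine hg _ fun j => ?_
    rw [← h i j]
    have : g j ∘ₗ (TensorProduct.lid ℂ W).toLinearMap ∘ₗ LinearMap.rTensor W (f i) =
        LinearMap.mul' ℂ ℂ ∘ₗ TensorProduct.map (f i) (g j) := by
      ext v w
      simp
    exact LinearMap.congr_fun this s
  -- Expanded along a basis of `W`, the tensor has coefficients in `V` killed by all `f i`.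
  refine (TensorProduct.equivFinsuppOfBasisRight e).injective ?_
  rw [map_zero]
  ext k
  refine hf _ fun i => ?_
  have : f i ∘ₗ Finsupp.lapply k ∘ₗ (TensorProduct.equivFinsuppOfBasisRight e).toLinearMap =
      e.coord k ∘ₗ (TensorProduct.lid ℂ W).toLinearMap ∘ₗ LinearMap.rTensor W (f i) := by
    ext v w
    simp [mul_comm]
  have h2 := LinearMap.congr_fun this s
  simp only [LinearMap.comp_apply, LinearEquiv.coe_coe, h1, map_zero] at h2
  exact h2

namespace Independence

variable (P : Independence.{u})
variable {A B : Type u} [NonUnitalRing A] [Module ℂ A] [IsScalarTower ℂ A A] [SMulCommClass ℂ A A]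
  [NonUnitalRing B] [Module ℂ B] [IsScalarTower ℂ B B] [SMulCommClass ℂ B B]

/-- The functional `S(φ) ⊗ S(ψ)` on `S(A) ⊗ S(B)`. -/
def symTensor {V W : Type*} [AddCommGroup V] [Module ℂ V] [AddCommGroup W] [Module ℂ W]
    (φ : V →ₗ[ℂ] ℂ) (ψ : W →ₗ[ℂ] ℂ) :
    SymmetricAlgebra ℂ V ⊗[ℂ] SymmetricAlgebra ℂ W →ₗ[ℂ] ℂ :=
  LinearMap.mul' ℂ ℂ ∘ₗ TensorProduct.map (SymmetricAlgebra.lift φ).toLinearMap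
    (SymmetricAlgebra.lift ψ).toLinearMap

theorem symTensor_tmul {V W : Type*} [AddCommGroup V] [Module ℂ V] [AddCommGroup W] [Module ℂ W]
    (φ : V →ₗ[ℂ] ℂ) (ψ : W →ₗ[ℂ] ℂ) (s : SymmetricAlgebra ℂ V) (t : SymmetricAlgebra ℂ W) :
    symTensor φ ψ (s ⊗ₜ t) = SymmetricAlgebra.lift φ s * SymmetricAlgebra.lift ψ t := by
  simp [symTensor]

theorem symTensor_ext {V W : Type*} [AddCommGroup V] [Module ℂ V] [AddCommGroup W] [Module ℂ W]
    {s t : SymmetricAlgebra ℂ V ⊗[ℂ] SymmetricAlgebra ℂ W}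
    (h : ∀ (φ : V →ₗ[ℂ] ℂ) (ψ : W →ₗ[ℂ] ℂ), symTensor φ ψ s = symTensor φ ψ t) : s = t := by
  rw [← sub_eq_zero]
  refine TensorProduct.eq_zero_of_map_eq_zero
    (fun φ : V →ₗ[ℂ] ℂ => (SymmetricAlgebra.lift φ).toLinearMap)
    (fun ψ : W →ₗ[ℂ] ℂ => (SymmetricAlgebra.lift ψ).toLinearMap)
    (fun v hv => SymmetricAlgebra.eq_zero_of_lift_eq_zero hv)
    (fun v hv => SymmetricAlgebra.eq_zero_of_lift_eq_zero hv) _ fun φ ψ => ?_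
  have := sub_eq_zero.2 (h φ ψ)
  rwa [← map_sub] at this

theorem headFactor_lift {V : Type*} [AddCommGroup V] [Module ℂ V] {ι : Type*} [DecidableEq ι]
    (φ : V →ₗ[ℂ] ℂ) (m : List ι → V) (i : ι) (l : List ι) :
    MomentFunctional.headFactor (fun l => φ (m l)) i l = SymmetricAlgebra.lift φ
      (MomentFunctional.headFactor (fun l => SymmetricAlgebra.ι ℂ V (m l)) i l) := by
  unfold MomentFunctional.headFactor
  split_ifs <;> simp

/-- The polynomial expansion is applied first in the left functional with `ψ` fixed, then in the
right one with the left functional replaced by a block functional. The remaining coefficients depend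
on neither `φ` nor `ψ`. -/
theorem exists_symTensor_eq_prod (x : AlgCoprod A B) :
    ∃ s : SymmetricAlgebra ℂ A ⊗[ℂ] SymmetricAlgebra ℂ B,
      ∀ (φ : A →ₗ[ℂ] ℂ) (ψ : B →ₗ[ℂ] ℂ), symTensor φ ψ s = P.prod φ ψ x := by
  classical
  have hx : x ∈ Submodule.span ℂ (WordTemplate.values A B) := by
    rw [WordTemplate.span_values]
    trivial
  induction hx using Submodule.span_induction with
  | zero => exact ⟨0, by simp⟩
  | add x y _ _ h1 h2 =>
    obtain ⟨s, hs⟩ := h1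
    obtain ⟨t, ht⟩ := h2
    exact ⟨s + t, fun φ ψ => by rw [map_add, map_add, hs, ht]⟩
  | smul c x _ h =>
    obtain ⟨s, hs⟩ := h
    exact ⟨c • s, fun φ ψ => by rw [map_smul, map_smul, hs]⟩
  | mem x hx =>
    obtain ⟨ι, κ, _, _, W, a, b, rfl⟩ := hx
    refine ⟨∑ c : ι → MomentFunctional.Label ι, ∑ d : κ → MomentFunctional.Label κ,
      P.prod (MomentFunctional.blockFunctional c) (MomentFunctional.blockFunctional d)
        (W.toFun (FreeAlgebra.ι ℂ) (FreeAlgebra.ι ℂ)) •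
      ((∏ i, MomentFunctional.headFactor
        (fun l => SymmetricAlgebra.ι ℂ A (MomentFunctional.wordProd a l)) i (c i).1) ⊗ₜ
      (∏ j, MomentFunctional.headFactor
        (fun l => SymmetricAlgebra.ι ℂ B (MomentFunctional.wordProd b l)) j (d j).1)),
      fun φ ψ => ?_⟩
    have h1 := (W.leftMoment P ψ b).toFun_eq_sum φ a
    have h2 := fun c : ι → MomentFunctional.Label ι =>
      (W.rightMoment P (MomentFunctional.blockFunctional c) (FreeAlgebra.ι ℂ)).toFun_eq_sum ψ b
    change P.prod φ ψ (W.toFun a b) = ∑ c : ι → MomentFunctional.Label ι,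
      P.prod (MomentFunctional.blockFunctional c) ψ (W.toFun (FreeAlgebra.ι ℂ) b) * _ at h1
    change ∀ c, P.prod (MomentFunctional.blockFunctional c) ψ (W.toFun (FreeAlgebra.ι ℂ) b) =
      ∑ d : κ → MomentFunctional.Label κ,
      P.prod (MomentFunctional.blockFunctional c) (MomentFunctional.blockFunctional d)
        (W.toFun (FreeAlgebra.ι ℂ) (FreeAlgebra.ι ℂ)) * _ at h2
    rw [h1, map_sum]
    refine Finset.sum_congr rfl fun c _ => ?_
    rw [h2, map_sum, Finset.sum_mul]
    refine Finset.sum_congr rfl fun d _ => ?_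
    rw [map_smul, symTensor_tmul, map_prod, map_prod, smul_eq_mul]
    simp only [headFactor_lift]
    ring

/-- The linear map `σ : A ⊔ B → S(A) ⊗ S(B)` with `φ ⊙ ψ = (S(φ) ⊗ S(ψ)) ∘ σ`. -/
def toSymTensor : AlgCoprod A B →ₗ[ℂ] SymmetricAlgebra ℂ A ⊗[ℂ] SymmetricAlgebra ℂ B where
  toFun x := (P.exists_symTensor_eq_prod x).choose
  -- The chosen element is determined by its values on pairs of characters, so the choice is
  -- automatically linear.
  map_add' x y := symTensor_ext fun φ ψ => by
    rw [map_add, (P.exists_symTensor_eq_prod _).choose_spec,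
      (P.exists_symTensor_eq_prod _).choose_spec, (P.exists_symTensor_eq_prod _).choose_spec,
      map_add]
  map_smul' c x := symTensor_ext fun φ ψ => by
    rw [map_smul, (P.exists_symTensor_eq_prod _).choose_spec,
      (P.exists_symTensor_eq_prod _).choose_spec, map_smul]
    rfl

theorem symTensor_toSymTensor (φ : A →ₗ[ℂ] ℂ) (ψ : B →ₗ[ℂ] ℂ) (x : AlgCoprod A B) :
    symTensor φ ψ (P.toSymTensor x) = P.prod φ ψ x :=
  (P.exists_symTensor_eq_prod x).choose_spec φ ψ

end Independence
end

noncomputable section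

open scoped TensorProduct

namespace DualSemigroup

/-! ### The comultiplication of `B₀` -/

section UnitizationMap

variable {C : Type v} {C' : Type w} [NonUnitalRing C] [Module ℂ C] [IsScalarTower ℂ C C]
  [SMulCommClass ℂ C C] [NonUnitalRing C'] [Module ℂ C'] [IsScalarTower ℂ C' C']
  [SMulCommClass ℂ C' C']

/-- The unital extension of a homomorphism to the unitizations. -/
def unitMap (f : C →ₙₐ[ℂ] C') : Unitization ℂ C →ₐ[ℂ] Unitization ℂ C' :=
  Unitization.lift ((Unitization.inrNonUnitalAlgHom ℂ C').comp f)

theorem unitMap_inr (f : C →ₙₐ[ℂ] C') (x : C) :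
    unitMap f (Unitization.inr x) = Unitization.inr (f x) := by
  simp [unitMap]

end UnitizationMap

variable {B : Type u} [Ring B] [Algebra ℂ B] [StarRing B] [StarModule ℂ B] (D : DualSemigroup B)

section Extend

variable {C : Type v} {C' : Type w} [NonUnitalRing C] [Module ℂ C] [IsScalarTower ℂ C C]
  [SMulCommClass ℂ C C] [NonUnitalRing C'] [Module ℂ C'] [IsScalarTower ℂ C' C']
  [SMulCommClass ℂ C' C']

/-- The unital extension to `B = ℂ1 ⊕ B₀` of a homomorphism defined on `B₀`. -/
def extend (p : D.aug →ₙₐ[ℂ] C) : B →ₐ[ℂ] Unitization ℂ C :=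
  (unitMap p).comp D.toUnitization

theorem toAug_coe (b : D.aug) : D.toAug b = b := by
  ext
  change (b : B) - algebraMap ℂ B (D.counit b) = b
  rw [show D.counit (b : B) = 0 from b.2]
  simp

theorem toUnitization_coe (b : D.aug) : D.toUnitization b = Unitization.inr b := by
  change Unitization.inl (D.counit b) + Unitization.inr (D.toAug b) = _
  rw [show D.counit (b : B) = 0 from b.2, toAug_coe]
  simp

theorem eq_algebraMap_add (b : B) : b = algebraMap ℂ B (D.counit b) + (D.toAug b : B) := by
  change b = algebraMap ℂ B (D.counit b) + (b - algebraMap ℂ B (D.counit b))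
  abel

theorem extend_coe (p : D.aug →ₙₐ[ℂ] C) (b : D.aug) : D.extend p b = Unitization.inr (p b) := by
  change unitMap p (D.toUnitization b) = _
  rw [toUnitization_coe, unitMap_inr]

variable {D} in
theorem algHom_ext_aug {A : Type*} [Ring A] [Algebra ℂ A] {F G : B →ₐ[ℂ] A}
    (h : ∀ b : D.aug, F b = G b) : F = G := by
  ext b
  rw [D.eq_algebraMap_add b, map_add, map_add, AlgHom.commutes, AlgHom.commutes, h]

variable {D} in
theorem extend_congr {p q : D.aug →ₙₐ[ℂ] C} (h : ∀ x, p x = q x) (b : B) :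
    D.extend p b = D.extend q b := by
  rw [show p = q from NonUnitalAlgHom.ext h]

theorem unitMap_comp_extend (f : C →ₙₐ[ℂ] C') (p : D.aug →ₙₐ[ℂ] C) :
    (unitMap f).comp (D.extend p) = D.extend (f.comp p) := by
  refine algHom_ext_aug (D := D) fun b => ?_
  rw [AlgHom.comp_apply, extend_coe, extend_coe, unitMap_inr]
  rfl

theorem unitMap_extend (f : C →ₙₐ[ℂ] C') (p : D.aug →ₙₐ[ℂ] C) (b : B) :
    unitMap f (D.extend p b) = D.extend (f.comp p) b :=
  DFunLike.congr_fun (D.unitMap_comp_extend f p) b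

end Extend

theorem coprodToUnitization_inl (b : B) :
    D.coprodToUnitization (UnitalCoprod.inl b) = D.extend AlgCoprod.inl b :=
  UnitalCoprod.lift_inl _ _ b

theorem coprodToUnitization_inr (b : B) :
    D.coprodToUnitization (UnitalCoprod.inr b) = D.extend AlgCoprod.inr b :=
  UnitalCoprod.lift_inr _ _ b

theorem lift_counit_comul (b : B) :
    UnitalCoprod.lift ((Algebra.ofId ℂ B).comp D.counit.toAlgHom) (AlgHom.id ℂ B) (D.comul b) = b :=
  DFunLike.congr_fun D.counit_left b

theorem lift_comul_counit (b : B) :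
    UnitalCoprod.lift (AlgHom.id ℂ B) ((Algebra.ofId ℂ B).comp D.counit.toAlgHom) (D.comul b) = b :=
  DFunLike.congr_fun D.counit_right b

theorem fst_extend {C : Type*} [NonUnitalRing C] [Module ℂ C] [IsScalarTower ℂ C C]
    [SMulCommClass ℂ C C] (p : D.aug →ₙₐ[ℂ] C) (b : B) : (D.extend p b).fst = D.counit b := by
  conv_lhs => rw [D.eq_algebraMap_add b]
  rw [map_add, AlgHom.commutes, extend_coe]
  simp [Unitization.algebraMap_eq_inl]

/-- The scalar part on `B ⊔₁ B` is the counit on both factors, hence factors through `δ ⊔₁ id`, and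
the counit law applies. It follows that `Δ` maps `B₀` into `B₀ ⊔ B₀`. -/
theorem fst_coprodToUnitization_comul (b : B) :
    (D.coprodToUnitization (D.comul b)).fst = D.counit b := by
  have h : (Unitization.fstHom ℂ (AlgCoprod D.aug D.aug)).comp D.coprodToUnitization =
      D.counit.toAlgHom.comp (UnitalCoprod.lift ((Algebra.ofId ℂ B).comp D.counit.toAlgHom)
        (AlgHom.id ℂ B)) := by
    refine UnitalCoprod.hom_ext (fun b => ?_) (fun b => ?_)
    · simp only [AlgHom.comp_apply, coprodToUnitization_inl, UnitalCoprod.lift_inl]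
      refine (D.fst_extend _ b).trans ?_
      exact ((D.counit.toAlgHom).commutes (D.counit b)).symm
    · simp only [AlgHom.comp_apply, coprodToUnitization_inr, UnitalCoprod.lift_inr]
      exact D.fst_extend _ b
  refine (DFunLike.congr_fun h (D.comul b)).trans ?_
  exact congrArg D.counit (D.lift_counit_comul b)

/-- The comultiplication `B₀ → B₀ ⊔ B₀`. -/
def augComul : D.aug →ₙₐ[ℂ] AlgCoprod D.aug D.aug where
  toFun b := (D.coprodToUnitization (D.comul b)).snd
  map_smul' c b := by simp
  map_zero' := by simp
  map_add' a b := by simp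
  map_mul' a b := by
    have h : ∀ b : D.aug, (D.coprodToUnitization (D.comul b)).fst = 0 := fun b =>
      (D.fst_coprodToUnitization_comul b).trans b.2
    simp [h]

theorem coprodToUnitization_comul_coe (b : D.aug) :
    D.coprodToUnitization (D.comul b) = Unitization.inr (D.augComul b) := by
  refine Unitization.ext ?_ rfl
  rw [fst_coprodToUnitization_comul]
  exact b.2

theorem coprodToUnitization_comul (b : B) :
    D.coprodToUnitization (D.comul b) = D.extend D.augComul b := by
  have h : D.coprodToUnitization.comp D.comul.toAlgHom = D.extend D.augComul := by
    refine algHom_ext_aug (D := D) fun b => ?_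
    rw [extend_coe]
    exact D.coprodToUnitization_comul_coe b
  exact DFunLike.congr_fun h b

section Coassoc

variable {C : Type v} [NonUnitalRing C] [Module ℂ C] [IsScalarTower ℂ C C] [SMulCommClass ℂ C C]

theorem lift_extend_comul (p q : D.aug →ₙₐ[ℂ] C) (b : B) :
    UnitalCoprod.lift (D.extend p) (D.extend q) (D.comul b) =
      D.extend ((AlgCoprod.lift p q).comp D.augComul) b := by
  have h : UnitalCoprod.lift (D.extend p) (D.extend q) =
      (unitMap (AlgCoprod.lift p q)).comp D.coprodToUnitization := by
    refine UnitalCoprod.hom_ext (fun b => ?_) (fun b => ?_)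
    · rw [UnitalCoprod.lift_inl, AlgHom.comp_apply, coprodToUnitization_inl, unitMap_extend]
      exact extend_congr (fun x => (AlgCoprod.lift_inl p q x).symm) b
    · rw [UnitalCoprod.lift_inr, AlgHom.comp_apply, coprodToUnitization_inr, unitMap_extend]
      exact extend_congr (fun x => (AlgCoprod.lift_inr p q x).symm) b
  rw [h, AlgHom.comp_apply, coprodToUnitization_comul, unitMap_extend]

/-- Coassociativity of `Δ` tested against three homomorphisms into a common target. This form avoids
identifying the threefold unital free product with a unitization. -/
theorem lift_augComul_coassoc (p q r : D.aug →ₙₐ[ℂ] C) (b : D.aug) :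
    AlgCoprod.lift ((AlgCoprod.lift p q).comp D.augComul) r (D.augComul b) =
      AlgCoprod.lift p ((AlgCoprod.lift q r).comp D.augComul) (D.augComul b) := by
  let Θ : UnitalCoprod B (UnitalCoprod B B) →ₐ[ℂ] Unitization ℂ C :=
    UnitalCoprod.lift (D.extend p) (UnitalCoprod.lift (D.extend q) (D.extend r))
  have h1 : Θ.comp (UnitalCoprod.map (AlgHom.id ℂ B) D.comul.toAlgHom) =
      UnitalCoprod.lift (D.extend p) (D.extend ((AlgCoprod.lift q r).comp D.augComul)) := by
    refine UnitalCoprod.hom_ext (fun b => ?_) (fun b => ?_)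
    · simp [UnitalCoprod.map, Θ]
    · rw [UnitalCoprod.lift_inr, ← lift_extend_comul]
      simp [UnitalCoprod.map, Θ]
  have h2 : (Θ.comp UnitalCoprod.assoc).comp (UnitalCoprod.map D.comul.toAlgHom (AlgHom.id ℂ B)) =
      UnitalCoprod.lift (D.extend ((AlgCoprod.lift p q).comp D.augComul)) (D.extend r) := by
    refine UnitalCoprod.hom_ext (fun b => ?_) (fun b => ?_)
    · have h3 : (Θ.comp UnitalCoprod.assoc).comp UnitalCoprod.inl =
          UnitalCoprod.lift (D.extend p) (D.extend q) := by
        refine UnitalCoprod.hom_ext (fun b => ?_) (fun b => ?_) <;> simp [UnitalCoprod.assoc, Θ]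
      rw [UnitalCoprod.lift_inl, ← lift_extend_comul, ← h3]
      simp [UnitalCoprod.map]
    · simp [UnitalCoprod.map, UnitalCoprod.assoc, Θ]
  have e1 := DFunLike.congr_fun h1 (D.comul b)
  have e2 := DFunLike.congr_fun h2 (D.comul b)
  rw [lift_extend_comul, extend_coe] at e1 e2
  refine Unitization.inr_injective (R := ℂ) (e2.symm.trans (Eq.trans ?_ e1))
  exact congrArg Θ (DFunLike.congr_fun D.coassoc (b : B))

end Coassoc

theorem augComul_coassoc (b : D.aug) :
    AlgCoprod.assoc (AlgCoprod.map D.augComul (NonUnitalAlgHom.id ℂ D.aug) (D.augComul b)) =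
      AlgCoprod.map (NonUnitalAlgHom.id ℂ D.aug) D.augComul (D.augComul b) := by
  have h := D.lift_augComul_coassoc (C := AlgCoprod D.aug (AlgCoprod D.aug D.aug)) AlgCoprod.inl
    (AlgCoprod.inr.comp AlgCoprod.inl) (AlgCoprod.inr.comp AlgCoprod.inr) b
  have h1 : AlgCoprod.assoc.comp (AlgCoprod.map D.augComul (NonUnitalAlgHom.id ℂ D.aug)) =
      AlgCoprod.lift ((AlgCoprod.lift AlgCoprod.inl (AlgCoprod.inr.comp AlgCoprod.inl)).comp
        D.augComul) (AlgCoprod.inr.comp AlgCoprod.inr) := by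
    refine AlgCoprod.hom_ext (fun b => ?_) (fun b => ?_) <;> simp [AlgCoprod.assoc, AlgCoprod.map]
  have h2 : (AlgCoprod.lift (AlgCoprod.inr.comp AlgCoprod.inl) (AlgCoprod.inr.comp AlgCoprod.inr) :
      AlgCoprod D.aug D.aug →ₙₐ[ℂ] AlgCoprod D.aug (AlgCoprod D.aug D.aug)) = AlgCoprod.inr := by
    refine AlgCoprod.hom_ext (fun b => ?_) (fun b => ?_) <;> simp
  rw [← h1, h2] at h
  exact h

theorem extend_id : D.extend (NonUnitalAlgHom.id ℂ D.aug) = D.toUnitization :=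
  algHom_ext_aug fun b => by rw [extend_coe, toUnitization_coe]; rfl

/-- The zero homomorphism on `B₀` corresponds to the counit on `B`, which turns the counit laws of
`Δ` into statements about `B₀`. -/
theorem extend_zero :
    D.extend (0 : D.aug →ₙₐ[ℂ] D.aug) =
      D.toUnitization.comp ((Algebra.ofId ℂ B).comp D.counit.toAlgHom) :=
  algHom_ext_aug fun b => by
    rw [extend_coe]
    change _ = D.toUnitization (algebraMap ℂ B (D.counit b))
    rw [show D.counit (b : B) = 0 from b.2]
    simp

theorem lift_zero_id_augComul (b : D.aug) :
    AlgCoprod.lift 0 (NonUnitalAlgHom.id ℂ D.aug) (D.augComul b) = b := by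
  have h : UnitalCoprod.lift (D.extend (0 : D.aug →ₙₐ[ℂ] D.aug))
      (D.extend (NonUnitalAlgHom.id ℂ D.aug)) =
      D.toUnitization.comp (UnitalCoprod.lift ((Algebra.ofId ℂ B).comp D.counit.toAlgHom)
        (AlgHom.id ℂ B)) := by
    refine UnitalCoprod.hom_ext (fun b => ?_) (fun b => ?_) <;> simp [extend_zero, extend_id]
  have h1 := DFunLike.congr_fun h (D.comul b)
  rw [lift_extend_comul, extend_coe, AlgHom.comp_apply, lift_counit_comul, toUnitization_coe] at h1
  exact Unitization.inr_injective h1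

theorem lift_id_zero_augComul (b : D.aug) :
    AlgCoprod.lift (NonUnitalAlgHom.id ℂ D.aug) 0 (D.augComul b) = b := by
  have h : UnitalCoprod.lift (D.extend (NonUnitalAlgHom.id ℂ D.aug))
      (D.extend (0 : D.aug →ₙₐ[ℂ] D.aug)) =
      D.toUnitization.comp (UnitalCoprod.lift (AlgHom.id ℂ B)
        ((Algebra.ofId ℂ B).comp D.counit.toAlgHom)) := by
    refine UnitalCoprod.hom_ext (fun b => ?_) (fun b => ?_) <;> simp [extend_zero, extend_id]
  have h1 := DFunLike.congr_fun h (D.comul b)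
  rw [lift_extend_comul, extend_coe, AlgHom.comp_apply, lift_comul_counit, toUnitization_coe] at h1
  exact Unitization.inr_injective h1

end DualSemigroup

/-! ### Products with the zero functional -/

namespace Independence

variable (P : Independence.{u})
variable {A B : Type u} [NonUnitalRing A] [Module ℂ A] [IsScalarTower ℂ A A] [SMulCommClass ℂ A A]
  [NonUnitalRing B] [Module ℂ B] [IsScalarTower ℂ B B] [SMulCommClass ℂ B B]

/-- The zero functional factors through the zero algebra, and `0 ⊔ B` is just `B`; naturality and
`prod_inr` then determine the product. -/
theorem prod_zero_left (ψ : B →ₗ[ℂ] ℂ) (x : AlgCoprod A B) :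
    P.prod 0 ψ x = ψ (AlgCoprod.lift 0 (NonUnitalAlgHom.id ℂ B) x) := by
  have h := P.prod_comp (0 : PUnit.{u + 1} →ₗ[ℂ] ℂ) ψ (0 : A →ₙₐ[ℂ] PUnit.{u + 1})
    (NonUnitalAlgHom.id ℂ B) x
  have e : AlgCoprod.map (0 : A →ₙₐ[ℂ] PUnit.{u + 1}) (NonUnitalAlgHom.id ℂ B) =
      AlgCoprod.inr.comp (AlgCoprod.lift 0 (NonUnitalAlgHom.id ℂ B)) := by
    refine AlgCoprod.hom_ext (fun a => ?_) (fun b => ?_)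
    · simpa [AlgCoprod.map] using map_zero (AlgCoprod.inl (A := PUnit.{u + 1}) (B := B))
    · simp [AlgCoprod.map]
  rw [e] at h
  exact h.trans (P.prod_inr _ _ _)

theorem prod_zero_right (φ : A →ₗ[ℂ] ℂ) (x : AlgCoprod A B) :
    P.prod φ 0 x = φ (AlgCoprod.lift (NonUnitalAlgHom.id ℂ A) 0 x) := by
  have h := P.prod_comp φ (0 : PUnit.{u + 1} →ₗ[ℂ] ℂ) (NonUnitalAlgHom.id ℂ A)
    (0 : B →ₙₐ[ℂ] PUnit.{u + 1}) x
  have e : AlgCoprod.map (NonUnitalAlgHom.id ℂ A) (0 : B →ₙₐ[ℂ] PUnit.{u + 1}) =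
      AlgCoprod.inl.comp (AlgCoprod.lift (NonUnitalAlgHom.id ℂ A) 0) := by
    refine AlgCoprod.hom_ext (fun a => ?_) (fun b => ?_)
    · simp [AlgCoprod.map]
    · simpa [AlgCoprod.map] using map_zero (AlgCoprod.inr (A := A) (B := PUnit.{u + 1}))
  rw [e] at h
  exact h.trans (P.prod_inl _ _ _)

end Independence

/-! ### The coalgebra structure on the symmetric tensor algebra -/

namespace DualSemigroup

open Independence

variable {B : Type u} [Ring B] [Algebra ℂ B] [StarRing B] [StarModule ℂ B] (D : DualSemigroup B)
  (P : Independence.{u})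

/-- The convolution of linear functionals on `B₀`. -/
def augConv (φ ψ : D.aug →ₗ[ℂ] ℂ) : D.aug →ₗ[ℂ] ℂ :=
  P.prod φ ψ ∘ₗ (D.augComul : D.aug →ₗ[ℂ] AlgCoprod D.aug D.aug)

theorem restrict_uconv (φ ψ : B →ₗ[ℂ] ℂ) :
    D.restrict (D.uconv P φ ψ) = D.augConv P (D.restrict φ) (D.restrict ψ) := by
  ext b
  change unitExt (P.prod (D.restrict φ) (D.restrict ψ)) (D.coprodToUnitization (D.comul b)) =
    P.prod (D.restrict φ) (D.restrict ψ) (D.augComul b)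
  rw [coprodToUnitization_comul_coe]
  simp [unitExt]

/-- Naturality moves the inner comultiplication from the functional to the argument, where
coassociativity meets associativity of `⊙`. -/
theorem augConv_assoc (φ ψ χ : D.aug →ₗ[ℂ] ℂ) :
    D.augConv P (D.augConv P φ ψ) χ = D.augConv P φ (D.augConv P ψ χ) := by
  ext b
  have h1 := P.prod_comp (P.prod φ ψ) χ D.augComul (NonUnitalAlgHom.id ℂ D.aug) (D.augComul b)
  have h2 := P.prod_comp φ (P.prod ψ χ) (NonUnitalAlgHom.id ℂ D.aug) D.augComul (D.augComul b)
  rw [P.prod_assoc, augComul_coassoc] at h1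
  exact h1.trans h2.symm

theorem augConv_zero_left (φ : D.aug →ₗ[ℂ] ℂ) : D.augConv P 0 φ = φ := by
  ext b
  exact (P.prod_zero_left φ _).trans (congrArg φ (D.lift_zero_id_augComul b))

theorem augConv_zero_right (φ : D.aug →ₗ[ℂ] ℂ) : D.augConv P φ 0 = φ := by
  ext b
  exact (P.prod_zero_right φ _).trans (congrArg φ (D.lift_id_zero_augComul b))

/-- The comultiplication of `S(B₀)`. -/
def symComul : D.Sym →ₐ[ℂ] D.Sym ⊗[ℂ] D.Sym :=
  D.symLift (P.toSymTensor ∘ₗ (D.augComul : D.aug →ₗ[ℂ] AlgCoprod D.aug D.aug))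

/-- The functional `S(φ) ⊗ S(ψ)` on `S(B₀) ⊗ S(B₀)` as an algebra homomorphism. -/
def symPair (φ ψ : D.aug →ₗ[ℂ] ℂ) : D.Sym ⊗[ℂ] D.Sym →ₐ[ℂ] ℂ :=
  Algebra.TensorProduct.productMap (D.symLift φ) (D.symLift ψ)

theorem symPair_tmul (φ ψ : D.aug →ₗ[ℂ] ℂ) (s t : D.Sym) :
    D.symPair φ ψ (s ⊗ₜ t) = D.symLift φ s * D.symLift ψ t := by
  simp [symPair]

/-- Both sides are characters in `s`, so generators suffice, and there it is the defining property
of `toSymTensor`. The coalgebra laws all reduce to this identity. -/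
theorem symPair_symComul (φ ψ : D.aug →ₗ[ℂ] ℂ) (s : D.Sym) :
    D.symPair φ ψ (D.symComul P s) = D.symLift (D.augConv P φ ψ) s := by
  have h : (D.symPair φ ψ).comp (D.symComul P) = D.symLift (D.augConv P φ ψ) := by
    refine SymmetricAlgebra.algHom_ext (LinearMap.ext fun b => ?_)
    have e : ∀ t, D.symPair φ ψ t = symTensor φ ψ t := fun t => by
      have : (D.symPair φ ψ).toLinearMap = symTensor φ ψ := TensorProduct.ext' fun x y =>
        (D.symPair_tmul φ ψ x y).trans (symTensor_tmul φ ψ x y).symm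
      exact LinearMap.congr_fun this t
    change D.symPair φ ψ (D.symComul P (D.symι b)) = D.symLift (D.augConv P φ ψ) (D.symι b)
    rw [symComul, symLift_symι, symLift_symι, e]
    exact P.symTensor_toSymTensor φ ψ _
  exact DFunLike.congr_fun h s

theorem sym_ext {s t : D.Sym} (h : ∀ φ : D.aug →ₗ[ℂ] ℂ, D.symLift φ s = D.symLift φ t) : s = t := by
  rw [← sub_eq_zero]
  refine SymmetricAlgebra.eq_zero_of_lift_eq_zero fun φ => ?_
  have := sub_eq_zero.2 (h φ)
  rwa [← map_sub] at this

theorem sym_tensor_ext {s t : D.Sym ⊗[ℂ] (D.Sym ⊗[ℂ] D.Sym)}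
    (h : ∀ φ ψ χ, LinearMap.mul' ℂ ℂ (TensorProduct.map (D.symLift φ).toLinearMap
      (D.symPair ψ χ).toLinearMap s) = LinearMap.mul' ℂ ℂ (TensorProduct.map
        (D.symLift φ).toLinearMap (D.symPair ψ χ).toLinearMap t)) : s = t := by
  rw [← sub_eq_zero]
  refine TensorProduct.eq_zero_of_map_eq_zero
    (fun φ : D.aug →ₗ[ℂ] ℂ => (D.symLift φ).toLinearMap)
    (fun p : (D.aug →ₗ[ℂ] ℂ) × (D.aug →ₗ[ℂ] ℂ) => (D.symPair p.1 p.2).toLinearMap)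
    (fun v hv => D.sym_ext fun φ => (hv φ).trans (map_zero _).symm)
    (fun w hw => ?_) _ fun φ p => ?_
  · refine TensorProduct.eq_zero_of_map_eq_zero
      (fun φ : D.aug →ₗ[ℂ] ℂ => (D.symLift φ).toLinearMap)
      (fun φ : D.aug →ₗ[ℂ] ℂ => (D.symLift φ).toLinearMap)
      (fun v hv => D.sym_ext fun φ => (hv φ).trans (map_zero _).symm)
      (fun v hv => D.sym_ext fun φ => (hv φ).trans (map_zero _).symm) _ fun φ ψ => ?_
    have e : LinearMap.mul' ℂ ℂ ∘ₗ TensorProduct.map (D.symLift φ).toLinearMap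
        (D.symLift ψ).toLinearMap = (D.symPair φ ψ).toLinearMap :=
      TensorProduct.ext' fun x y => by simp [symPair_tmul]
    exact (LinearMap.congr_fun e w).trans (hw (φ, ψ))
  · rw [map_sub, map_sub, h, sub_self]

/-- The coalgebra structure on `S(B₀)` determined by `⊙` and `Δ`. -/
@[reducible]
def symCoalgebra : Coalgebra ℂ D.Sym where
  comul := (D.symComul P).toLinearMap
  counit := D.symExt 0
  coassoc := by
    ext s
    refine D.sym_tensor_ext fun φ ψ χ => ?_
    have h1 : LinearMap.mul' ℂ ℂ ∘ₗ TensorProduct.map (D.symLift φ).toLinearMap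
        (D.symPair ψ χ).toLinearMap ∘ₗ (TensorProduct.assoc ℂ D.Sym D.Sym D.Sym).toLinearMap ∘ₗ
          LinearMap.rTensor D.Sym (D.symComul P).toLinearMap =
        (D.symPair (D.augConv P φ ψ) χ).toLinearMap := by
      refine TensorProduct.ext' fun x y => ?_
      -- With the last leg `y` fixed, the reassociated functional can be compared on pure tensors
      -- and then applied to the nonpure tensor `D.symComul P x`.
      have h2 : LinearMap.mul' ℂ ℂ ∘ₗ TensorProduct.map (D.symLift φ).toLinearMap
          (D.symPair ψ χ).toLinearMap ∘ₗ (TensorProduct.assoc ℂ D.Sym D.Sym D.Sym).toLinearMap ∘ₗ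
            (TensorProduct.mk ℂ (D.Sym ⊗[ℂ] D.Sym) D.Sym).flip y =
          D.symLift χ y • (D.symPair φ ψ).toLinearMap := by
        refine TensorProduct.ext' fun u v => ?_
        simp [symPair_tmul]
        ring
      refine (LinearMap.congr_fun h2 (D.symComul P x)).trans ?_
      simp [symPair_tmul, symPair_symComul, mul_comm]
    have h3 : LinearMap.mul' ℂ ℂ ∘ₗ TensorProduct.map (D.symLift φ).toLinearMap
        (D.symPair ψ χ).toLinearMap ∘ₗ LinearMap.lTensor D.Sym (D.symComul P).toLinearMap =
        (D.symPair φ (D.augConv P ψ χ)).toLinearMap := by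
      refine TensorProduct.ext' fun x y => ?_
      simp [symPair_tmul, symPair_symComul]
    refine (LinearMap.congr_fun h1 (D.symComul P s)).trans
      (Eq.trans ?_ (LinearMap.congr_fun h3 (D.symComul P s)).symm)
    simp only [AlgHom.toLinearMap_apply, symPair_symComul, augConv_assoc]
  rTensor_counit_comp_comul := by
    ext s
    refine (TensorProduct.lid ℂ D.Sym).injective (D.sym_ext fun φ => ?_)
    have h : (D.symLift φ).toLinearMap ∘ₗ (TensorProduct.lid ℂ D.Sym).toLinearMap ∘ₗ
        LinearMap.rTensor D.Sym (D.symExt 0) = (D.symPair 0 φ).toLinearMap := by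
      refine TensorProduct.ext' fun x y => ?_
      simp [symPair_tmul, symExt, restrict]
    refine (LinearMap.congr_fun h (D.symComul P s)).trans ?_
    simp [symPair_symComul, augConv_zero_left]
  lTensor_counit_comp_comul := by
    ext s
    refine (TensorProduct.rid ℂ D.Sym).injective (D.sym_ext fun φ => ?_)
    have h : (D.symLift φ).toLinearMap ∘ₗ (TensorProduct.rid ℂ D.Sym).toLinearMap ∘ₗ
        LinearMap.lTensor D.Sym (D.symExt 0) = (D.symPair φ 0).toLinearMap := by
      refine TensorProduct.ext' fun x y => ?_
      simp [symPair_tmul, symExt, restrict, mul_comm]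
    refine (LinearMap.congr_fun h (D.symComul P s)).trans ?_
    simp [symPair_symComul, augConv_zero_right]

theorem isInduced_symCoalgebra : @IsInduced B _ _ _ _ D P (D.symCoalgebra P) := by
  let _ := D.symCoalgebra P
  refine ⟨map_one (D.symComul P), map_mul (D.symComul P), rfl, fun φ ψ _ _ => ?_⟩
  ext s
  have e : (D.symPair (D.restrict φ) (D.restrict ψ)).toLinearMap =
      LinearMap.mul' ℂ ℂ ∘ₗ TensorProduct.map (D.symExt φ) (D.symExt ψ) :=
    TensorProduct.ext' fun x y => by simp [symPair_tmul, symExt]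
  refine Eq.trans ?_ (LinearMap.congr_fun e (D.symComul P s))
  refine Eq.trans ?_ (D.symPair_symComul P _ _ s).symm
  rw [← restrict_uconv]
  rfl

end DualSemigroup
end

noncomputable section

open scoped TensorProduct Topology

/-! ### Convolution of functionals and matrices -/

namespace CoalgebraConvolution

open Coalgebra (comul counit coassoc_apply)

variable {C : Type u} [AddCommGroup C] [Module ℂ C] [Coalgebra ℂ C]

/-- The operator `(id ⊗ F) ∘ Δ` of convolution with a functional. -/
def convOperator : (C →ₗ[ℂ] ℂ) →ₗ[ℂ] C →ₗ[ℂ] C where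
  toFun F := (TensorProduct.rid ℂ C).toLinearMap ∘ₗ LinearMap.lTensor C F ∘ₗ comul
  map_add' F G := by ext c; simp [LinearMap.lTensor_add]
  map_smul' r F := by ext c; simp [LinearMap.lTensor_smul]

theorem convOperator_apply (F : C →ₗ[ℂ] ℂ) (c : C) :
    convOperator F c = TensorProduct.rid ℂ C (LinearMap.lTensor C F (comul c)) := rfl

theorem convOperator_counit (c : C) : convOperator (counit (R := ℂ)) c = c := by
  simp [convOperator_apply]

theorem counit_convOperator (F : C →ₗ[ℂ] ℂ) (c : C) :
    counit (R := ℂ) (convOperator F c) = F c := by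
  have h : (counit (R := ℂ) (A := C)) ∘ₗ (TensorProduct.rid ℂ C).toLinearMap ∘ₗ
      LinearMap.lTensor C F = F ∘ₗ (TensorProduct.lid ℂ C).toLinearMap ∘ₗ
        LinearMap.rTensor C (counit (R := ℂ)) :=
    TensorProduct.ext' fun x y => by simp [mul_comm]
  refine (LinearMap.congr_fun h (comul c)).trans ?_
  simp

/-- By coassociativity both sides are `c₁ F(c₂) G(c₃)`. Convolving on the right leg keeps the order
of the factors, so a homomorphism results rather than an antihomomorphism. -/
theorem convOperator_mul (F G : WithConv (C →ₗ[ℂ] ℂ)) (c : C) :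
    convOperator (F * G).ofConv c = convOperator F.ofConv (convOperator G.ofConv c) := by
  let Φ : C ⊗[ℂ] (C ⊗[ℂ] C) →ₗ[ℂ] C := (TensorProduct.rid ℂ C).toLinearMap ∘ₗ
    LinearMap.lTensor C (LinearMap.mul' ℂ ℂ ∘ₗ TensorProduct.map F.ofConv G.ofConv)
  have h1 : Φ ∘ₗ LinearMap.lTensor C comul =
      (TensorProduct.rid ℂ C).toLinearMap ∘ₗ LinearMap.lTensor C (F * G).ofConv :=
    TensorProduct.ext' fun x y => by simp [Φ, LinearMap.convMul_def]
  have h2 : Φ ∘ₗ (TensorProduct.assoc ℂ C C C).toLinearMap ∘ₗ LinearMap.rTensor C comul =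
      convOperator F.ofConv ∘ₗ (TensorProduct.rid ℂ C).toLinearMap ∘ₗ
        LinearMap.lTensor C G.ofConv := by
    refine TensorProduct.ext' fun x y => ?_
    have h3 : Φ ∘ₗ (TensorProduct.assoc ℂ C C C).toLinearMap ∘ₗ
        (TensorProduct.mk ℂ (C ⊗[ℂ] C) C).flip y =
        G.ofConv y • ((TensorProduct.rid ℂ C).toLinearMap ∘ₗ LinearMap.lTensor C F.ofConv) :=
      TensorProduct.ext' fun u v => by simp [Φ, smul_smul, mul_comm]
    refine (LinearMap.congr_fun h3 (comul x)).trans ?_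
    simp [convOperator_apply]
  refine (LinearMap.congr_fun h1 (comul c)).symm.trans (Eq.trans ?_
    (LinearMap.congr_fun h2 (comul c)))
  simp only [LinearMap.comp_apply, LinearEquiv.coe_coe, coassoc_apply]

/-- The subcomodule generated by an element. -/
def orbit (c : C) : Submodule ℂ C := LinearMap.range (convOperator.flip c)

theorem mem_orbit (c : C) : c ∈ orbit c := ⟨counit, convOperator_counit c⟩

theorem convOperator_mem_orbit (c : C) (F : C →ₗ[ℂ] ℂ) : ∀ x ∈ orbit c,
    convOperator F x ∈ orbit c := by
  rintro _ ⟨G, rfl⟩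
  exact ⟨(WithConv.toConv F * WithConv.toConv G).ofConv, convOperator_mul _ _ c⟩

/-- The comultiplication of `c` is a finite sum of pure tensors, and their left legs span a space
containing the orbit. -/
instance (c : C) : FiniteDimensional ℂ (orbit c) := by
  obtain ⟨S, hS⟩ := TensorProduct.exists_finset (R := ℂ) (comul c)
  have h : orbit c ≤ Submodule.span ℂ ((fun p : C × C => p.1) '' S) := by
    rintro _ ⟨F, rfl⟩
    change convOperator F c ∈ _
    rw [convOperator_apply, hS, map_sum, map_sum]
    refine Submodule.sum_mem _ fun p hp => ?_
    simp only [LinearMap.lTensor_tmul, TensorProduct.rid_tmul]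
    exact Submodule.smul_mem _ _ (Submodule.subset_span ⟨p, hp, rfl⟩)
  have : FiniteDimensional ℂ (Submodule.span ℂ ((fun p : C × C => p.1) '' S)) :=
    FiniteDimensional.span_of_finite ℂ (S.finite_toSet.image _)
  exact Submodule.finiteDimensional_of_le h

/-- The representation of the convolution algebra on the subcomodule generated by an element. -/
def orbitRep (c : C) : WithConv (C →ₗ[ℂ] ℂ) →ₐ[ℂ] Module.End ℂ (orbit c) :=
  AlgHom.ofLinearMap
    { toFun := fun F => (convOperator F.ofConv).restrict (convOperator_mem_orbit c F.ofConv)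
      map_add' := fun F G => by ext; simp
      map_smul' := fun r F => by ext; simp }
    (by
      ext x
      change convOperator _ (x : C) = x
      exact convOperator_counit (x : C))
    (fun F G => by
      ext x
      exact convOperator_mul F G x)

/-- Convolution of functionals is represented by matrices whose entries are values of the
functionals. -/
theorem exists_matrix_rep (c : C) : ∃ (n : ℕ)
    (ρ : WithConv (C →ₗ[ℂ] ℂ) →ₐ[ℂ] Matrix (Fin n) (Fin n) ℂ) (m : Fin n → Fin n → C)
    (l : Matrix (Fin n) (Fin n) ℂ →ₗ[ℂ] ℂ),
    (∀ F i j, ρ F i j = F.ofConv (m i j)) ∧ ∀ F, F.ofConv c = l (ρ F) := by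
  let b := Module.finBasis ℂ (orbit c)
  have hext : ∀ i, ∃ g : C →ₗ[ℂ] ℂ, g ∘ₗ (orbit c).subtype = b.coord i := fun i =>
    LinearMap.exists_extend (b.coord i)
  choose g hg using hext
  -- The matrix coefficients are `(g i ⊗ id)(Δ (b j))`, where `g i` extends the `i`-th coordinate
  -- from the orbit to `C`. The functional `l` applies the operator to `c` and then the counit,
  -- which recovers `F c`.
  refine ⟨_, ((LinearMap.toMatrixAlgEquiv b).toAlgHom).comp (orbitRep c),
    fun i j => TensorProduct.lid ℂ C (LinearMap.rTensor C (g i) (comul (b j : C))),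
    (counit (R := ℂ)) ∘ₗ (orbit c).subtype ∘ₗ
      LinearMap.applyₗ (⟨c, mem_orbit c⟩ : orbit c) ∘ₗ
      ((LinearMap.toMatrixAlgEquiv b).symm.toLinearMap), fun F i j => ?_, fun F => ?_⟩
  · have h1 : (LinearMap.toMatrixAlgEquiv b) (orbitRep c F) i j =
        b.coord i (orbitRep c F (b j)) := by
      rw [LinearMap.toMatrixAlgEquiv_apply]
      rfl
    refine h1.trans ?_
    rw [← hg i]
    have h2 : g i ∘ₗ (TensorProduct.rid ℂ C).toLinearMap ∘ₗ LinearMap.lTensor C F.ofConv =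
        F.ofConv ∘ₗ (TensorProduct.lid ℂ C).toLinearMap ∘ₗ LinearMap.rTensor C (g i) :=
      TensorProduct.ext' fun x y => by simp [mul_comm]
    exact LinearMap.congr_fun h2 (comul (b j : C))
  · have h1 : (LinearMap.toMatrixAlgEquiv b).symm
        ((LinearMap.toMatrixAlgEquiv b) (orbitRep c F)) = orbitRep c F :=
      (LinearMap.toMatrixAlgEquiv b).symm_apply_apply _
    change _ = counit (R := ℂ) (((LinearMap.toMatrixAlgEquiv b).symm
        ((LinearMap.toMatrixAlgEquiv b) (orbitRep c F)) ⟨c, mem_orbit c⟩ : orbit c) : C)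
    rw [h1]
    exact (counit_convOperator F.ofConv c).symm

end CoalgebraConvolution

/-! ### Products which converge to an exponential -/

section Banach

variable {𝔸 : Type*} [NormedRing 𝔸] [NormedAlgebra ℝ 𝔸] [CompleteSpace 𝔸]

/-- Exponential bounds multiply along a product, giving a bound by the total time that is
independent of the number of factors. -/
theorem norm_le_exp_of_hasDerivWithinAt (h1 : ‖(1 : 𝔸)‖ ≤ 1) {U : ℝ → 𝔸} {X : 𝔸} (hU0 : U 0 = 1)
    (hU : HasDerivWithinAt U X (Set.Ici 0) 0) :
    ∀ᶠ t in 𝓝[≥] (0 : ℝ), ‖U t‖ ≤ Real.exp (t * (‖X‖ + 1)) := by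
  have h := (hasDerivWithinAt_iff_isLittleO.1 hU).bound one_pos
  filter_upwards [h, self_mem_nhdsWithin] with t ht ht0
  simp only [sub_zero, hU0, one_mul] at ht
  have ht0 : 0 ≤ t := ht0
  rw [Real.norm_of_nonneg ht0] at ht
  have e : U t = (U t - 1 - t • X) + (1 + t • X) := by abel
  calc ‖U t‖ = ‖(U t - 1 - t • X) + (1 + t • X)‖ := by rw [← e]
    _ ≤ t + (1 + t * ‖X‖) := by
      refine (norm_add_le _ _).trans (add_le_add ht ((norm_add_le _ _).trans (add_le_add h1 ?_)))
      rw [norm_smul, Real.norm_of_nonneg ht0]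
    _ = t * (‖X‖ + 1) + 1 := by ring
    _ ≤ _ := Real.add_one_le_exp _

/-- A product of elements `U(t)` over small increments `t ≥ 0` which sum up to `τ` is close to the
exponential `exp(τX)`, where `X` is the derivative of `U` at zero. -/
theorem exists_norm_prod_sub_exp_le (h1 : ‖(1 : 𝔸)‖ ≤ 1) {U : ℝ → 𝔸} {X : 𝔸} (hU0 : U 0 = 1)
    (hU : HasDerivWithinAt U X (Set.Ici 0) 0) (τ : ℝ) {ε : ℝ} (hε : 0 < ε) :
    ∃ η > 0, ∀ l : List ℝ, (∀ t ∈ l, 0 ≤ t ∧ t ≤ η) → l.sum = τ →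
      ‖(l.map U).prod - NormedSpace.exp (τ • X)‖ ≤ ε := by
  let V : ℝ → 𝔸 := fun t => NormedSpace.exp (t • X)
  have hV0 : V 0 = 1 := by simp [V]
  have hV : HasDerivWithinAt V X (Set.Ici 0) 0 := by
    have := (hasDerivAt_exp_smul_const X (0 : ℝ)).hasDerivWithinAt (s := Set.Ici 0)
    simpa [V] using this
  have hadd : ∀ s t, V (s + t) = V s * V t := fun s t => by
    let _ : NormedAlgebra ℚ 𝔸 := NormedAlgebra.restrictScalars ℚ ℝ 𝔸
    simp only [V]
    rw [add_smul]
    exact NormedSpace.exp_add_of_commute (((Commute.refl X).smul_left s).smul_right t)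
  set M := ‖X‖ + 1
  have hM : 0 ≤ M := by positivity
  -- The accumulated error will be `ε' * τ * exp(τM)`. The absolute value is used because `τ ≥ 0` is
  -- known only once a list with this sum is given.
  obtain ⟨ε', hε', hε''⟩ : ∃ ε' > 0, ε' * (|τ| * Real.exp (τ * M)) ≤ ε := by
    refine ⟨ε / (|τ| * Real.exp (τ * M) + 1), by positivity, ?_⟩
    rw [div_mul_eq_mul_div, div_le_iff₀ (by positivity)]
    nlinarith [abs_nonneg τ, Real.exp_pos (τ * M)]
  have hUV := ((hasDerivWithinAt_iff_isLittleO.1 (hU.sub hV))).bound hε'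
  have hev := (norm_le_exp_of_hasDerivWithinAt h1 hU0 hU).and
    ((norm_le_exp_of_hasDerivWithinAt h1 hV0 hV).and hUV)
  rw [eventually_nhdsWithin_iff, Metric.eventually_nhds_iff] at hev
  obtain ⟨η, hη, hev⟩ := hev
  -- Halving turns the strict bound on the distance into the closed condition `t ≤ η / 2`.
  refine ⟨η / 2, by positivity, fun l hl hs => ?_⟩
  have key : ∀ l : List ℝ, (∀ t ∈ l, 0 ≤ t ∧ t ≤ η / 2) → 0 ≤ l.sum ∧
      ‖(l.map U).prod‖ ≤ Real.exp (l.sum * M) ∧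
      ‖(l.map U).prod - V l.sum‖ ≤ ε' * (l.sum * Real.exp (l.sum * M)) := by
    intro l
    induction l with
    | nil => intro _; simp [hV0, h1]
    | cons t l ih =>
      intro h
      obtain ⟨i0, i1, i2⟩ := ih fun s hs => h s (List.mem_cons_of_mem _ hs)
      obtain ⟨ht0, ht1⟩ := h t List.mem_cons_self
      obtain ⟨j1, j2, j3⟩ := hev (y := t)
        (by rw [Real.dist_eq, sub_zero, abs_of_nonneg ht0]; linarith) ht0
      simp only [Pi.sub_apply, hU0, hV0, sub_self, sub_zero, smul_zero,
        Real.norm_of_nonneg ht0] at j3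
      rw [List.map_cons, List.prod_cons, List.sum_cons]
      have e : Real.exp ((t + l.sum) * M) = Real.exp (t * M) * Real.exp (l.sum * M) := by
        rw [add_mul, Real.exp_add]
      have e1 : 1 ≤ Real.exp (t * M) := Real.one_le_exp (mul_nonneg ht0 hM)
      refine ⟨add_nonneg ht0 i0, ?_, ?_⟩
      · rw [e]
        exact (norm_mul_le _ _).trans (mul_le_mul j1 i1 (norm_nonneg _) (Real.exp_pos _).le)
      · rw [hadd, e]
        -- Telescoping: replace one factor at a time, paying `ε' * t` for each replacement.
        have e2 : U t * (l.map U).prod - V t * V l.sum =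
            (U t - V t) * (l.map U).prod + V t * ((l.map U).prod - V l.sum) := by noncomm_ring
        rw [e2]
        calc _ ≤ ε' * t * Real.exp (l.sum * M) +
              Real.exp (t * M) * (ε' * (l.sum * Real.exp (l.sum * M))) := by
              refine (norm_add_le _ _).trans (add_le_add ?_ ?_)
              · exact (norm_mul_le _ _).trans (mul_le_mul j3 i1 (norm_nonneg _)
                  (mul_nonneg hε'.le ht0))
              · exact (norm_mul_le _ _).trans (mul_le_mul j2 i2 (norm_nonneg _) (Real.exp_pos _).le)
          _ ≤ Real.exp (t * M) * (ε' * t * Real.exp (l.sum * M)) +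
              Real.exp (t * M) * (ε' * (l.sum * Real.exp (l.sum * M))) := by
              exact add_le_add (le_mul_of_one_le_left
                (mul_nonneg (mul_nonneg hε'.le ht0) (Real.exp_pos _).le) e1) le_rfl
          _ = _ := by ring
  obtain ⟨k0, -, k2⟩ := key l hl
  rw [hs] at k0 k2
  rw [abs_of_nonneg k0] at hε''
  exact k2.trans hε''

end Banach

/-! ### Partitions of small mesh -/

namespace IntervalPartition

theorem sum_zipWith_tail (T : ℝ) : ∀ (a : ℝ) (l : List ℝ), (a :: l).Pairwise (· < ·) →
    (∀ x ∈ a :: l, x ≤ T) → T ∈ a :: l →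
    (List.zipWith (fun s t => t - s) (a :: l) l).sum = T - a
  | a, [], _, _, hT => by
    obtain rfl : T = a := by simpa using hT
    simp
  | a, b :: l, hp, hle, hT => by
    have hb : T ∈ b :: l := by
      rcases List.mem_cons.1 hT with rfl | h
      · have h1 := (List.pairwise_cons.1 hp).1 b List.mem_cons_self
        exact absurd (hle b (by simp)) (not_le.2 h1)
      · exact h
    have h := sum_zipWith_tail T b l (List.pairwise_cons.1 hp).2
      (fun x hx => hle x (List.mem_cons_of_mem _ hx)) hb
    rw [List.zipWith_cons_cons, List.sum_cons, h]
    ring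

/-- Consecutive points of an increasing list have no point of the list strictly between them; the
mesh estimate uses this gap. -/
theorem exists_of_mem_zipWith_tail {d : ℝ} : ∀ (a : ℝ) (l : List ℝ), (a :: l).Pairwise (· < ·) →
    d ∈ List.zipWith (fun s t => t - s) (a :: l) l →
    ∃ s ∈ a :: l, ∃ t ∈ a :: l, s < t ∧ d = t - s ∧ ∀ x ∈ a :: l, x ≤ s ∨ t ≤ x
  | a, [], _, hd => by simp at hd
  | a, b :: l, hp, hd => by
    obtain ⟨h1, h2⟩ := List.pairwise_cons.1 hp
    rw [List.zipWith_cons_cons, List.mem_cons] at hd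
    rcases hd with rfl | hd
    · refine ⟨a, by simp, b, by simp, h1 b (by simp), rfl, fun x hx => ?_⟩
      rcases List.mem_cons.1 hx with rfl | hx
      · exact Or.inl le_rfl
      · rcases List.mem_cons.1 hx with rfl | hx
        · exact Or.inr le_rfl
        · exact Or.inr ((List.pairwise_cons.1 h2).1 x hx).le
    · obtain ⟨s, hs, t, ht, hst, rfl, h⟩ := exists_of_mem_zipWith_tail b l h2 hd
      refine ⟨s, List.mem_cons_of_mem _ hs, t, List.mem_cons_of_mem _ ht, hst, rfl, fun x hx => ?_⟩
      rcases List.mem_cons.1 hx with rfl | hx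
      · exact Or.inl (h1 s hs).le
      · exact h x hx

variable {S T : ℝ}

theorem exists_sort_eq_cons (α : IntervalPartition S T) :
    ∃ l : List ℝ, α.1.sort (· ≤ ·) = S :: l := by
  have hm : ∀ x, x ∈ α.1.sort (· ≤ ·) ↔ x ∈ α.1 := fun x => Finset.mem_sort _
  have hp := (Finset.sortedLT_sort α.1).pairwise
  match hl : α.1.sort (· ≤ ·) with
  | [] =>
    have := (hm S).2 α.2.1
    simp [hl] at this
  | a :: l =>
    rw [hl] at hp hm
    have ha : a ∈ α.1 := (hm a).1 List.mem_cons_self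
    have hS : S ≤ a := (α.2.2.2 ha).1
    rcases List.mem_cons.1 ((hm S).2 α.2.1) with rfl | h
    · exact ⟨l, rfl⟩
    · exact absurd ((List.pairwise_cons.1 hp).1 S h) (not_lt.2 hS)

theorem sum_steps (α : IntervalPartition S T) : α.steps.sum = T - S := by
  obtain ⟨l, hl⟩ := α.exists_sort_eq_cons
  have hm : ∀ x, x ∈ α.1.sort (· ≤ ·) ↔ x ∈ α.1 := fun x => Finset.mem_sort _
  have hp := (Finset.sortedLT_sort α.1).pairwise
  rw [hl] at hm hp
  rw [steps, hl]
  exact sum_zipWith_tail T S l hp (fun x hx => (α.2.2.2 ((hm x).1 hx)).2) ((hm T).2 α.2.2.1)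

theorem exists_of_mem_steps (α : IntervalPartition S T) {d : ℝ} (hd : d ∈ α.steps) :
    ∃ s ∈ α.1, ∃ t ∈ α.1, s < t ∧ d = t - s ∧ ∀ x ∈ α.1, x ≤ s ∨ t ≤ x := by
  obtain ⟨l, hl⟩ := α.exists_sort_eq_cons
  have hm : ∀ x, x ∈ α.1.sort (· ≤ ·) ↔ x ∈ α.1 := fun x => Finset.mem_sort _
  have hp := (Finset.sortedLT_sort α.1).pairwise
  rw [hl] at hm hp
  rw [steps, hl] at hd
  obtain ⟨s, hs, t, ht, h1, h2, h3⟩ := exists_of_mem_zipWith_tail S l hp hd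
  exact ⟨s, (hm s).1 hs, t, (hm t).1 ht, h1, h2, fun x hx => h3 x ((hm x).2 hx)⟩

theorem steps_nonneg (α : IntervalPartition S T) : ∀ d ∈ α.steps, 0 ≤ d := fun d hd => by
  obtain ⟨s, _, t, _, h, rfl, _⟩ := α.exists_of_mem_steps hd
  linarith

/-- The steps of a partition become arbitrarily small. -/
theorem eventually_steps_le (hST : S ≤ T) {η : ℝ} (hη : 0 < η) :
    ∀ᶠ α : IntervalPartition S T in Filter.atTop, ∀ d ∈ α.steps, d ≤ η := by
  classical
  obtain ⟨N, hN⟩ := exists_nat_gt ((T - S) / η)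
  have hN0 : (0 : ℝ) < N := lt_of_le_of_lt (div_nonneg (sub_nonneg.2 hST) hη.le) hN
  set h := (T - S) / N with hh
  have h0 : 0 ≤ h := div_nonneg (sub_nonneg.2 hST) hN0.le
  have hNh : N * h = T - S := by rw [hh]; field_simp
  have hle : h ≤ η := by
    rw [div_lt_iff₀ hη] at hN
    rw [hh, div_le_iff₀ hN0]
    linarith
  -- An equidistant partition with `N` cells of length `h ≤ η`; every finer partition inherits the
  -- mesh bound.
  let α₀ : IntervalPartition S T := ⟨(Finset.range (N + 1)).image fun i : ℕ => S + i * h, by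
    refine ⟨Finset.mem_image.2 ⟨0, by simp, by simp⟩,
      Finset.mem_image.2 ⟨N, by simp, by rw [hNh]; ring⟩, ?_⟩
    intro x hx
    obtain ⟨i, hi, rfl⟩ := Finset.mem_image.1 (Finset.mem_coe.1 hx)
    have hi : (i : ℝ) ≤ N := by exact_mod_cast Nat.lt_succ_iff.1 (Finset.mem_range.1 hi)
    have h2 := mul_le_mul_of_nonneg_right hi h0
    constructor
    · have : 0 ≤ i * h := by positivity
      linarith
    · linarith⟩
  filter_upwards [Filter.eventually_ge_atTop α₀] with α hα d hd
  obtain ⟨s, hs, t, ht, hst, rfl, hgap⟩ := α.exists_of_mem_steps hd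
  have hs1 := α.2.2.2 hs
  have ht1 := α.2.2.2 ht
  have hpos : 0 < h := by
    have : 0 < T - S := by linarith [hs1.1, ht1.2]
    exact div_pos this hN0
  -- The grid cell containing `s`: its right end lies beyond `s` and belongs to `α`, so the gap
  -- property puts it at or beyond `t`, whence `t - s ≤ h`.
  set i := ⌊(s - S) / h⌋₊
  have hi1 : i * h ≤ s - S := by
    rw [← le_div_iff₀ hpos]
    exact Nat.floor_le (div_nonneg (sub_nonneg.2 hs1.1) hpos.le)
  have hi2 : s - S < (i + 1) * h := by
    rw [← div_lt_iff₀ hpos]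
    exact Nat.lt_floor_add_one _
  have hiN : i < N := by
    have : (i : ℝ) * h < N * h := by linarith [ht1.2]
    exact_mod_cast lt_of_mul_lt_mul_right this h0
  have hmem : S + ((i + 1 : ℕ) : ℝ) * h ∈ α.1 :=
    hα (Finset.mem_image.2 ⟨i + 1, by simpa using hiN, rfl⟩)
  push_cast at hmem
  rcases hgap _ hmem with h3 | h3
  · linarith
  · linarith

end IntervalPartition
end

noncomputable section

open scoped TensorProduct Topology

/-! ### The limit theorem -/

namespace CoalgebraConvolution

open scoped Matrix.Norms.Operator

variable {C : Type u} [AddCommGroup C] [Module ℂ C] [Coalgebra ℂ C]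

/-- Only an inequality, since the identity matrix of size zero has norm `0`. -/
theorem _root_.Matrix.linfty_opNorm_one_le {n : Type*} [Fintype n] [DecidableEq n] :
    ‖(1 : Matrix n n ℂ)‖ ≤ 1 := by
  rw [← Matrix.diagonal_one, Matrix.linfty_opNorm_diagonal]
  exact (pi_norm_le_iff_of_nonneg zero_le_one).2 fun i => by simp

/-- The series is the image of a matrix exponential series under a linear functional, which is
continuous in finite dimension. -/
theorem convExp_hasSum (F : C →ₗ[ℂ] ℂ) (c : C) : HasSum
    (fun n : ℕ => ((n.factorial : ℂ))⁻¹ * (WithConv.toConv F ^ n) c) (convExp F c) := by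
  obtain ⟨n, ρ, m, l, -, hl⟩ := exists_matrix_rep c
  have h := (NormedSpace.exp_series_hasSum_exp' (𝕂 := ℂ) (ρ (WithConv.toConv F))).mapL
    (LinearMap.toContinuousLinearMap l)
  have e : (fun n : ℕ => ((n.factorial : ℂ))⁻¹ * (WithConv.toConv F ^ n) c) =
      fun n : ℕ => LinearMap.toContinuousLinearMap l
        (((n.factorial : ℂ))⁻¹ • ρ (WithConv.toConv F) ^ n) := by
    funext k
    rw [← map_pow, map_smul, smul_eq_mul]
    exact congrArg _ (hl _)
  rw [← e] at h
  exact h.summable.hasSum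

/-- Entrywise differentiability lives in the product norm; the identity map to the operator norm is
continuous because the space is finite dimensional. -/
theorem hasDerivWithinAt_matrix {n : ℕ} {U : ℝ → Matrix (Fin n) (Fin n) ℂ}
    {X : Matrix (Fin n) (Fin n) ℂ} {s : Set ℝ} {x : ℝ}
    (h : ∀ i j, HasDerivWithinAt (fun t => U t i j) (X i j) s x) : HasDerivWithinAt U X s x := by
  let Λ : (Fin n → Fin n → ℂ) →ₗ[ℝ] Matrix (Fin n) (Fin n) ℂ :=
    { toFun := fun f => Matrix.of f
      map_add' := fun _ _ => rfl
      map_smul' := fun _ _ => rfl }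
  have h1 : HasDerivWithinAt (fun t => (U t : Fin n → Fin n → ℂ)) X s x :=
    hasDerivWithinAt_pi.2 fun i => hasDerivWithinAt_pi.2 fun j => h i j
  exact (LinearMap.toContinuousLinearMap Λ).hasFDerivAt.comp_hasDerivWithinAt x h1

/-- If `U(t)` are functionals on a coalgebra with `U(0)` the counit and pointwise derivative `F` at
zero, then convolution products of `U(t)` along partitions converge to `exp_∗((T - S) F)`. -/
theorem tendsto_prod_steps {U : ℝ → WithConv (C →ₗ[ℂ] ℂ)} {F : C →ₗ[ℂ] ℂ} (hU0 : U 0 = 1)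
    (hU : ∀ c, HasDerivWithinAt (fun t => (U t).ofConv c) (F c) (Set.Ici 0) 0) {S T : ℝ}
    (hST : S ≤ T) (c : C) :
    Filter.Tendsto (fun α : IntervalPartition S T => ((α.steps.map U).prod).ofConv c) Filter.atTop
      (𝓝 (convExp (((T - S : ℝ) : ℂ) • F) c)) := by
  obtain ⟨n, ρ, m, l, hm, hl⟩ := exists_matrix_rep c
  set X := ρ (WithConv.toConv F)
  have hX : convExp (((T - S : ℝ) : ℂ) • F) c = l (NormedSpace.exp ((T - S) • X)) := by
    have h := (NormedSpace.exp_series_hasSum_exp' (𝕂 := ℂ) ((T - S) • X)).mapL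
      (LinearMap.toContinuousLinearMap l)
    have eX : (T - S) • X = ρ (WithConv.toConv (((T - S : ℝ) : ℂ) • F)) := by
      rw [WithConv.toConv_smul, map_smul]
      ext i j
      simp [X]
    have e : (fun k : ℕ => ((k.factorial : ℂ))⁻¹ *
        (WithConv.toConv (((T - S : ℝ) : ℂ) • F) ^ k) c) =
        fun k : ℕ => LinearMap.toContinuousLinearMap l
          (((k.factorial : ℂ))⁻¹ • ((T - S) • X) ^ k) := by
      funext k
      rw [eX, ← map_pow, map_smul, smul_eq_mul]
      exact congrArg _ (hl _)
    rw [← e] at h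
    exact (convExp_hasSum _ c).unique h
  have hlim : Filter.Tendsto (fun α : IntervalPartition S T => (α.steps.map fun t => ρ (U t)).prod)
      Filter.atTop (𝓝 (NormedSpace.exp ((T - S) • X))) := by
    refine Metric.tendsto_nhds.2 fun ε hε => ?_
    obtain ⟨η, hη, h⟩ := exists_norm_prod_sub_exp_le Matrix.linfty_opNorm_one_le
      (U := fun t => ρ (U t)) (X := X) (by rw [hU0, map_one])
      (hasDerivWithinAt_matrix fun i j => by
        simp only [hm, X]
        exact hU (m i j)) (T - S) (half_pos hε)
    filter_upwards [IntervalPartition.eventually_steps_le hST hη] with α hα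
    rw [dist_eq_norm]
    exact (h _ (fun t ht => ⟨α.steps_nonneg t ht, hα t ht⟩) α.sum_steps).trans_lt (half_lt_self hε)
  rw [hX]
  have h := ((LinearMap.toContinuousLinearMap l).continuous.tendsto _).comp hlim
  refine h.congr fun α => ?_
  rw [hl, map_list_prod, List.map_map]
  rfl

end CoalgebraConvolution

/-! ### Functionals on `B` and their extensions to `S(B₀)` -/

namespace DualSemigroup

variable {B : Type u} [Ring B] [Algebra ℂ B] [StarRing B] [StarModule ℂ B] (D : DualSemigroup B)
  (P : Independence.{u})

theorem uconv_one (φ ψ : B →ₗ[ℂ] ℂ) : D.uconv P φ ψ 1 = 1 := by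
  change unitExt _ (D.coprodToUnitization (D.comul 1)) = 1
  rw [map_one, map_one]
  simp [unitExt]

theorem counitₗ_one : D.counitₗ 1 = 1 := map_one D.counit

theorem uconvList_one (l : List (B →ₗ[ℂ] ℂ)) : D.uconvList P l 1 = 1 := by
  cases l with
  | nil => exact D.counitₗ_one
  | cons φ l => exact D.uconv_one P _ _

theorem symExt_toSym {φ : B →ₗ[ℂ] ℂ} (h : φ 1 = 1) (b : B) : D.symExt φ (D.toSym b) = φ b := by
  change D.symLift (D.restrict φ) (algebraMap ℂ D.Sym (D.counit b) + D.symι (D.toAug b)) = φ b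
  conv_rhs => rw [D.eq_algebraMap_add b]
  rw [map_add, map_add, AlgHom.commutes, symLift_symι, Algebra.algebraMap_eq_smul_one,
    Algebra.algebraMap_eq_smul_one, map_smul, h]
  rfl

/-- The counit vanishes on `B₀`. Thus the empty `⊎`-product corresponds to the unit of convolution.
-/
theorem symExt_counitₗ : D.symExt D.counitₗ = D.symExt 0 := by
  have h : D.restrict D.counitₗ = D.restrict 0 := by
    ext b
    exact b.2
  rw [symExt, h, symExt]

theorem symExt_uconvList [Coalgebra ℂ D.Sym] (hI : D.IsInduced P) (l : List (B →ₗ[ℂ] ℂ))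
    (hl : ∀ φ ∈ l, φ 1 = 1) : WithConv.toConv (D.symExt (D.uconvList P l)) =
      (l.map fun φ => WithConv.toConv (D.symExt φ)).prod := by
  induction l with
  | nil =>
    change WithConv.toConv (D.symExt D.counitₗ) = 1
    rw [symExt_counitₗ, ← hI.counit_eq]
    rfl
  | cons φ l ih =>
    rw [List.map_cons, List.prod_cons, ← ih fun ψ hψ => hl ψ (List.mem_cons_of_mem _ hψ)]
    exact hI.symExt_uconv _ _ (hl φ List.mem_cons_self) (D.uconvList_one P l)

@[elab_as_elim]
theorem sym_induction {motive : D.Sym → Prop} (algebraMap : ∀ r, motive (algebraMap ℂ D.Sym r))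
    (ι : ∀ b, motive (D.symι b)) (mul : ∀ x y, motive x → motive y → motive (x * y))
    (add : ∀ x y, motive x → motive y → motive (x + y)) (x : D.Sym) : motive x :=
  SymmetricAlgebra.induction ℂ D.aug algebraMap ι mul add x

/-- If the functionals `k t` on `B₀` vanish at `t = 0` and have derivative `Ψ` there, then the
homomorphisms `S(k t)` have derivative `D(Ψ)`. -/
theorem hasDerivWithinAt_symExt {k : ℝ → B →ₗ[ℂ] ℂ} {Ψ : B →ₗ[ℂ] ℂ} {s : Set ℝ}
    (h0 : ∀ b : D.aug, k 0 b = 0)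
    (hk : ∀ b : D.aug, HasDerivWithinAt (fun t => k t b) (Ψ b) s 0) (x : D.Sym) :
    HasDerivWithinAt (fun t => D.symExt (k t) x) (D.degreeOne Ψ x) s 0 := by
  -- A homomorphism to the dual numbers whose first component is `S(k 0)` and whose second is
  -- `D(Ψ)`; its multiplicativity is the Leibniz rule that matches the derivative of a product.
  let f := D.symLift (TrivSqZeroExt.inrHom ℂ ℂ ∘ₗ D.restrict Ψ)
  have hf : ∀ x, (f x).fst = D.symExt (k 0) x := fun x => by
    have h : (TrivSqZeroExt.fstHom ℂ ℂ ℂ).comp f = D.symLift (D.restrict (k 0)) := by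
      refine SymmetricAlgebra.algHom_ext (LinearMap.ext fun b => ?_)
      change (f (D.symι b)).fst = D.symLift (D.restrict (k 0)) (D.symι b)
      simp only [f, symLift_symι]
      simpa [restrict] using (h0 b).symm
    exact DFunLike.congr_fun h x
  change HasDerivWithinAt (fun t => D.symExt (k t) x) (f x).snd s 0
  induction x using D.sym_induction with
  | algebraMap r =>
    have e : ∀ t, D.symExt (k t) (algebraMap ℂ D.Sym r) = r := fun t =>
      (D.symLift (D.restrict (k t))).commutes r
    simp only [e, AlgHom.commutes]
    exact hasDerivWithinAt_const _ _ _
  | ι b =>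
    have e : ∀ t, D.symExt (k t) (D.symι b) = k t b := fun t => D.symLift_symι _ b
    simp only [e, f, symLift_symι]
    exact hk b
  | mul x y hx hy =>
    have e : ∀ t, D.symExt (k t) (x * y) = D.symExt (k t) x * D.symExt (k t) y := fun t =>
      map_mul (D.symLift (D.restrict (k t))) x y
    have h := hx.mul hy
    simp only [← hf] at h
    have e1 : (f (x * y)).snd = (f x).snd * (f y).fst + (f x).fst * (f y).snd := by
      rw [map_mul, TrivSqZeroExt.snd_mul]
      simp only [smul_eq_mul, MulOpposite.smul_eq_mul_unop, MulOpposite.unop_op]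
      ring
    rw [e1]
    simp only [e]
    exact h
  | add x y hx hy =>
    have e : (f (x + y)).snd = (f x).snd + (f y).snd := by rw [map_add]; rfl
    rw [e]
    simp only [map_add]
    exact hx.add hy

/-- The derivative at zero of functionals `δ + tΨ + O(t²)`. -/
theorem hasDerivWithinAt_of_expansion {k R : ℝ → B →ₗ[ℂ] ℂ} {Ψ : B →ₗ[ℂ] ℂ}
    (hk : ∀ t, 0 ≤ t → k t = D.counitₗ + (t : ℂ) • Ψ + R t) {b : B}
    (hR : ∃ C ε : ℝ, 0 < ε ∧ ∀ t, 0 ≤ t → t ≤ ε → ‖R t b‖ ≤ t ^ 2 * C) :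
    k 0 b = D.counit b ∧ HasDerivWithinAt (fun t => k t b) (Ψ b) (Set.Ici 0) 0 := by
  obtain ⟨C, ε, hε, h⟩ := hR
  have hk' : ∀ t, 0 ≤ t → k t b = D.counit b + t * Ψ b + R t b := fun t ht => by
    rw [hk t ht]
    rfl
  -- At `t = 0` the quadratic bound forces the remainder to vanish, so `k 0` agrees with the counit.
  have hR0 : R 0 b = 0 := by simpa using h 0 le_rfl hε.le
  have hk0 : k 0 b = D.counit b := by simpa [hR0] using hk' 0 le_rfl
  refine ⟨hk0, ?_⟩
  rw [hasDerivWithinAt_iff_isLittleO]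
  have hO : (fun t => R t b) =O[𝓝[≥] 0] fun t : ℝ => t ^ 2 := by
    refine Asymptotics.IsBigO.of_bound C ?_
    filter_upwards [self_mem_nhdsWithin, mem_nhdsWithin_of_mem_nhds (Iic_mem_nhds hε)] with t h0 h1
    rw [Real.norm_of_nonneg (sq_nonneg t), mul_comm]
    exact h t h0 h1
  have ho : (fun t : ℝ => t ^ 2) =o[𝓝[≥] 0] fun t : ℝ => t - 0 := by
    have := (Asymptotics.isLittleO_pow_id (𝕜 := ℝ) one_lt_two).mono
      (nhdsWithin_le_nhds (s := Set.Ici 0))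
    simpa using this
  refine (hO.trans_isLittleO ho).congr' ?_ Filter.EventuallyEq.rfl
  filter_upwards [self_mem_nhdsWithin] with t h0
  rw [hk' t h0, hk0]
  simp only [sub_zero, Complex.real_smul]
  ring

end DualSemigroup

end
theorem mainTheorem6 {B : Type u} [Ring B] [Algebra ℂ B] [StarRing B] [StarModule ℂ B]
    (D : DualSemigroup B) (P : Independence.{u}) :
    (∃ _ : Coalgebra ℂ D.Sym, D.IsInduced P) ∧
    ∀ [Coalgebra ℂ D.Sym], D.IsInduced P →
      ∀ (k R : ℝ → B →ₗ[ℂ] ℂ) (Ψ : B →ₗ[ℂ] ℂ),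
        (∀ t, 0 ≤ t → k t = D.counitₗ + (t : ℂ) • Ψ + R t) →
        Ψ 1 = 0 →
        (∀ t, 0 ≤ t → R t 1 = 0) →
        (∀ b : B, ∃ C ε : ℝ, 0 < ε ∧ ∀ t, 0 ≤ t → t ≤ ε → ‖R t b‖ ≤ t ^ 2 * C) →
        ∀ S T : ℝ, S ≤ T →
          (∀ s : D.Sym, Summable fun n : ℕ => ((n.factorial : ℂ))⁻¹ *
            (WithConv.toConv (((T - S : ℝ) : ℂ) • D.degreeOne Ψ) ^ n) s) ∧
          ∀ b : B, Filter.Tendsto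
            (fun α : IntervalPartition S T => D.uconvList P (α.steps.map k) b) Filter.atTop
            (nhds (convExp (((T - S : ℝ) : ℂ) • D.degreeOne Ψ) (D.toSym b))) := by
  refine ⟨⟨D.symCoalgebra P, D.isInduced_symCoalgebra P⟩, ?_⟩
  intro _ hI k R Ψ hk hΨ hR1 hR S T hST
  refine ⟨fun s => (CoalgebraConvolution.convExp_hasSum _ s).summable, fun b => ?_⟩
  have hk1 : ∀ t, 0 ≤ t → k t 1 = 1 := fun t ht => by
    simp [hk t ht, hΨ, hR1 t ht, D.counitₗ_one]
  have hd := fun b : B => D.hasDerivWithinAt_of_expansion hk (hR b)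
  have h0 : ∀ b : D.aug, k 0 b = 0 := fun b => (hd b).1.trans b.2
  have hlim := CoalgebraConvolution.tendsto_prod_steps
    (U := fun t => WithConv.toConv (D.symExt (k t))) (F := D.degreeOne Ψ) ?_
    (D.hasDerivWithinAt_symExt h0 fun b => (hd b).2) hST (D.toSym b)
  · refine hlim.congr fun α => ?_
    have h := D.symExt_uconvList P hI (α.steps.map k) fun φ hφ => by
      obtain ⟨t, ht, rfl⟩ := List.mem_map.1 hφ
      exact hk1 t (α.steps_nonneg t ht)
    rw [List.map_map] at h
    -- A normed functional on `B` is recovered from its extension to `S(B₀)`, so the limit can be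
    -- read off at `D.toSym b`.
    rw [← D.symExt_toSym (D.uconvList_one P _) b]
    exact congrArg (fun F => F.ofConv (D.toSym b)) h.symm
  · have e : k 0 = D.counitₗ := LinearMap.ext fun b => (hd b).1
    change WithConv.toConv (D.symExt (k 0)) = 1
    rw [e, D.symExt_counitₗ, ← hI.counit_eq]
    rfl
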